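/- Let $q=p_1^{r_1}\cdots p_t^{r_t}$ ($t\ge 0$), where $p_1,\dots,p_t$ are distinct odd primes and $r_j\ge 1$. Put $P_j=p_j^{r_j}$, $n_j=P_1+\dots+P_j$ ($n_0=0$) and $n=n_t$. Let $B_n$ be the Artin braid group with standard generators $\sigma_1,\dots,\sigma_{n-1}$, $P_n$ the pure braid group (the kernel of $B_n\to S_n$, $\sigma_i\mapsto(i,i+1)$), and $\overline\sigma\colon B_n/[P_n,P_n]\to S_n$ the induced homomorphism. In $B_n/[P_n,P_n]$ put, for $1\le a<b\le n$ and $1\le j\le t$, $$A_{a,b}=\sigma_{b-1}\cdots\sigma_{a+1}\sigma_a^2\sigma_{a+1}^{-1}\cdots\sigma_{b-1}^{-1},\qquad \delta_{n_{j-1},P_j}=\sigma_{n_j-1}\cdots\sigma_{n_{j-1}+\frac{P_j+1}{2}}\,\sigma_{n_{j-1}+\frac{P_j-1}{2}}^{-1}\cdots\sigma_{n_{j-1}+1}^{-1},$$ $$\delta=\delta_{n_0,P_1}\cdots\delta_{n_{t-1},P_t},\qquad x_j=A_{n_{j-1}+1,\,n_{j-1}+2}\,\delta_{n_{j-1},P_j}.$$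 Let $\Gamma_q\le B_n/[P_n,P_n]$ be the subgroup generated by $x_1,\dots,x_t$ and all $A_{a,b}^{\,q}$ ($1\le a<b\le n$), and let $\mathbb Z_q\le S_n$ be the subgroup generated by $\overline\sigma(\delta)$. Let $\mathcal B$ be the family consisting of - $e_{j,0,1}=x_j^{P_j}$ and $e_{j,0,k+1}=\delta^{k-1}A_{n_{j-1}+2,\,n_{j-1}+3}^{\,q}\,\delta^{-(k-1)}$, for $1\le j\le t$, $1\le k\le P_j-1$; - $e_{j,h,k}=\delta^{k-1}A_{n_{j-1}+1,\,n_{j-1}+h+2}^{\,q}\,\delta^{-(k-1)}$, for $1\le j\le t$, $1\le h\le\frac{P_j-3}{2}$, $1\le k\le P_j$; - $f_{a,b,k}=\delta^{k-1}A_{n_{a-1}+1,\,n_{b-1}+1}^{\,q}\,\delta^{-(k-1)}$, for $1\le a<b\le t$, $1\le k\le P_aP_b$. Then $\mathbb Z_q$ is cyclic of order $q$, and $\overline\sigma$ restricts to a surjection in a short exact sequence $$1\to\mathbb Z^{\frac{n(n-1)}2}\to\Gamma_q\xrightarrow{\ \overline\sigma\ }\mathbb Z_q\to1$$ in which the standard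 basis of $\mathbb Z^{\frac{n(n-1)}2}$ is mapped bijectively onto the family $\mathcal B$ (so $\mathcal B$ is a basis of the kernel). Moreover $\Gamma_q$ has a presentation with generators the elements of $\mathcal B$ and $x_1,\dots,x_t$, and relations 1. any two elements of $\mathcal B$ commute, and $x_ix_j=x_jx_i$ for all $i,j$; 2. $x_j^{P_j}=e_{j,0,1}$ for $1\le j\le t$; 3. for $1\le j\le t$, with the index $k+1$ read modulo $P_j$, $$x_j\,e_{j,h,k}\,x_j^{-1}=\begin{cases}e_{j,0,1},&h=0,\ k=1,\\ e_{j,0,k+1},&h=0,\ 2\le k\le P_j-1,\\ e_{j,0,1}^{\,q}\prod_{l=1}^{P_j-1}e_{j,0,l+1}^{-1},&h=0,\ k=P_j,\\ e_{j,h,k+1},&1\le h\le\frac{P_j-3}{2},\ 1\le k\le P_j;\end{cases}$$ 4. $(x_ax_b)\,f_{a,b,k}\,(x_ax_b)^{-1}=f_{a,b,k+1}$ for $1\le a<b\le t$, $1\le k\le P_aP_b$, with $k+1$ read modulo $P_aP_b$; 5. $x_i\,e_{j,h,k}\,x_i^{-1}=e_{j,h,k}$ for $i\ne j$, and $x_i\,f_{a,b,k}\,x_i^{-1}=f_{a,b,k}$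 for $i\notin\{a,b\}$. -/

import Mathlib

namespace BraidBieberbach

/-- Defining relators of the Artin braid group on `n` strings. The standard generator
`σ_{i+1}` is the letter `i : Fin (n - 1)`. -/
def braidRelators (n : ℕ) : Set (FreeGroup (Fin (n - 1))) :=
  {w | ∃ i j : Fin (n - 1), (i : ℕ) + 2 ≤ (j : ℕ) ∧
      w = FreeGroup.of i * FreeGroup.of j * (FreeGroup.of j * FreeGroup.of i)⁻¹} ∪
  {w | ∃ i j : Fin (n - 1), (j : ℕ) = (i : ℕ) + 1 ∧
      w = FreeGroup.of j * FreeGroup.of i * FreeGroup.of j *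
        (FreeGroup.of i * FreeGroup.of j * FreeGroup.of i)⁻¹}

/-- The Artin braid group `B_n`. -/
abbrev BraidGroup (n : ℕ) : Type := PresentedGroup (braidRelators n)

/-- The transposition of the neighbours `i`, `i + 1` (counted from `0`). -/
def adjSwap (n : ℕ) (i : Fin (n - 1)) : Equiv.Perm (Fin n) :=
  Equiv.swap ⟨(i : ℕ), by omega⟩ ⟨(i : ℕ) + 1, by omega⟩

theorem adjSwap_relators (n : ℕ) :
    ∀ w ∈ braidRelators n, FreeGroup.lift (adjSwap n) w = 1 := by
  rintro w (⟨i, j, hij, rfl⟩ | ⟨i, j, hij, rfl⟩)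
  · rw [map_mul, map_inv, mul_inv_eq_one]
    simp only [map_mul, FreeGroup.lift_apply_of]
    refine (Equiv.Perm.Disjoint.commute ?_).eq
    unfold adjSwap
    rw [Equiv.Perm.disjoint_iff_disjoint_support, Equiv.Perm.support_swap (by simp),
      Equiv.Perm.support_swap (by simp)]
    simp only [Finset.disjoint_left, Finset.mem_insert, Finset.mem_singleton, Fin.ext_iff]
    intro x hx
    omega
  · rw [map_mul, map_inv, mul_inv_eq_one]
    simp only [map_mul, FreeGroup.lift_apply_of]
    have hj : adjSwap n j = Equiv.swap ⟨(i : ℕ) + 1, by omega⟩ ⟨(i : ℕ) + 2, by omega⟩ := by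
      simp only [adjSwap, hij]
    rw [hj]
    unfold adjSwap
    have key : ∀ x y z : Fin n, x ≠ y → x ≠ z → y ≠ z →
        Equiv.swap y z * Equiv.swap x y * Equiv.swap y z =
          Equiv.swap x y * Equiv.swap y z * Equiv.swap x y := by
      intro x y z hxy hxz hyz
      rw [Equiv.swap_mul_swap_mul_swap hxy hxz, Equiv.swap_comm x y, Equiv.swap_comm y z,
        Equiv.swap_mul_swap_mul_swap hyz.symm hxz.symm, Equiv.swap_comm]
    exact key _ _ _ (by simp) (by simp) (by simp)

/-- The projection `B_n → S_n`, `σ_i ↦ (i, i+1)`. -/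
def braidPerm (n : ℕ) : BraidGroup n →* Equiv.Perm (Fin n) :=
  PresentedGroup.toGroup (adjSwap_relators n)

/-- The pure braid group `P_n`. -/
def pureBraid (n : ℕ) : Subgroup (BraidGroup n) := (braidPerm n).ker

instance (n : ℕ) : (pureBraid n).Normal := by
  unfold pureBraid; infer_instance

/-- The quotient `B_n / [P_n, P_n]`. -/
abbrev BraidQuot (n : ℕ) : Type := BraidGroup n ⧸ ⁅pureBraid n, pureBraid n⁆

/-- The homomorphism `B_n / [P_n, P_n] → S_n` induced by `braidPerm`. -/
def permBar (n : ℕ) : BraidQuot n →* Equiv.Perm (Fin n) :=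
  QuotientGroup.lift _ (braidPerm n)
    (show ⁅pureBraid n, pureBraid n⁆ ≤ pureBraid n from Subgroup.commutator_le_left _ _)

/-- The class of `σ_i` in `B_n / [P_n, P_n]`, for `1 ≤ i ≤ n - 1` (and `1` outside that range). -/
def sig (n i : ℕ) : BraidQuot n :=
  if h : 1 ≤ i ∧ i < n then
    QuotientGroup.mk (PresentedGroup.of (⟨i - 1, by omega⟩ : Fin (n - 1)))
  else 1

/-- The descending product `f b * f (b - 1) * ⋯ * f a` (empty if `b < a`). -/
def descProd {G : Type*} [Group G] (f : ℕ → G) (a b : ℕ) : G :=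
  ((List.range' a (b + 1 - a)).reverse.map f).prod

/-- `A_{i,j} = σ_{j-1} ⋯ σ_{i+1} σ_i² σ_{i+1}⁻¹ ⋯ σ_{j-1}⁻¹`, for `1 ≤ i < j ≤ n`. -/
def pureGen (n i j : ℕ) : BraidQuot n :=
  descProd (sig n) (i + 1) (j - 1) * sig n i ^ 2 * (descProd (sig n) (i + 1) (j - 1))⁻¹

/-- `δ_{m,z} = σ_{m+z-1} ⋯ σ_{m+(z+1)/2} σ_{m+(z-1)/2}⁻¹ ⋯ σ_{m+1}⁻¹`, for odd `z`. -/
def deltaBlock (n m z : ℕ) : BraidQuot n :=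
  descProd (sig n) (m + (z + 1) / 2) (m + z - 1) *
    descProd (fun i => (sig n i)⁻¹) (m + 1) (m + (z - 1) / 2)

section Blocks

/- `P j` is the prime power of block `j`; blocks are counted from `0`. -/
variable {t : ℕ} (P : Fin t → ℕ)

/-- The number of strings, `n = ∑ P_j`. -/
def strands : ℕ := ∑ j, P j

/-- `q = ∏ P_j`. -/
def order : ℕ := ∏ j, P j

/-- The number of strings in the blocks that precede block `j`. -/
def offset (j : Fin t) : ℕ := ∑ i ∈ Finset.Iio j, P i

/-- The rank `n (n - 1) / 2`. -/
def latticeRank : ℕ := strands P * (strands P - 1) / 2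

/-- `δ_{m,P_j}`, where `m` is the offset of block `j`. -/
def delta (j : Fin t) : BraidQuot (strands P) :=
  deltaBlock (strands P) (offset P j) (P j)

/-- The product of the elements `delta j`, in increasing order of `j`. -/
def deltaTotal : BraidQuot (strands P) := (List.ofFn (delta P)).prod

/-- `x_j = A_{m+1,m+2} δ_{m,P_j}`, where `m` is the offset of block `j`. -/
def rotElt (j : Fin t) : BraidQuot (strands P) :=
  pureGen (strands P) (offset P j + 1) (offset P j + 2) * delta P j

/-- The group `Γ_q`: the subgroup of `B_n / [P_n, P_n]` generated by the elements `x_j` and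
by the powers `A_{a,b}^q`, `1 ≤ a < b ≤ n`. -/
def Gamma : Subgroup (BraidQuot (strands P)) :=
  Subgroup.closure (Set.range (rotElt P) ∪
    {g | ∃ a b : ℕ, 1 ≤ a ∧ a < b ∧ b ≤ strands P ∧ g = pureGen (strands P) a b ^ order P})

/-- The subgroup `ℤ_q` of `S_n`, generated by the permutation of `δ`. -/
def holonomy : Subgroup (Equiv.Perm (Fin (strands P))) :=
  Subgroup.zpowers (permBar (strands P) (deltaTotal P))

/-- `δ^s g^q δ^{-s}`. -/
def deltaConj (s : ℕ) (g : BraidQuot (strands P)) : BraidQuot (strands P) :=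
  deltaTotal P ^ s * g ^ order P * (deltaTotal P ^ s)⁻¹

/-- Indices of the lattice generators.
`inner j h k` stands for `e_{j,h,k+1}`, with `0 ≤ h ≤ (P_j - 3)/2` and `1 ≤ k + 1 ≤ P_j`.
`cross a b _ k`, `a < b`, stands for the `(k+1)`-st generator, `1 ≤ k + 1 ≤ P_a P_b`, of the
family of the pair of blocks `a`, `b`. -/
inductive LatticeIndex : Type
  | inner (j : Fin t) (h : Fin ((P j - 1) / 2)) (k : Fin (P j)) : LatticeIndex
  | cross (a b : Fin t) (hab : a < b) (k : Fin (P a * P b)) : LatticeIndex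

/-- The lattice generators, as elements of `B_n / [P_n, P_n]`. -/
def latticeElt : LatticeIndex P → BraidQuot (strands P)
  | .inner j h k =>
      if (h : ℕ) = 0 then
        if (k : ℕ) = 0 then rotElt P j ^ P j
        else deltaConj P ((k : ℕ) - 1)
          (pureGen (strands P) (offset P j + 2) (offset P j + 3))
      else deltaConj P (k : ℕ)
        (pureGen (strands P) (offset P j + 1) (offset P j + (h : ℕ) + 2))
  | .cross a b _ k =>
      deltaConj P (k : ℕ) (pureGen (strands P) (offset P a + 1) (offset P b + 1))

/-- The generating symbols of the presentation. -/
abbrev PresGen : Type := LatticeIndex P ⊕ Fin t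

/-- The letter of a lattice generator. -/
def symE (i : LatticeIndex P) : FreeGroup (PresGen P) := FreeGroup.of (Sum.inl i)

/-- The letter of `x_j`. -/
def symX (j : Fin t) : FreeGroup (PresGen P) := FreeGroup.of (Sum.inr j)

/-- `PresRel P u v`: the relation `u = v` belongs to the presentation.
`finRotate N k` is `k + 1` modulo `N`. -/
inductive PresRel : FreeGroup (PresGen P) → FreeGroup (PresGen P) → Prop
  /-- The lattice generators commute. -/
  | lattice_comm (i i' : LatticeIndex P) :
      PresRel (symE P i * symE P i') (symE P i' * symE P i)
  /-- The `x_j` commute. -/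
  | rot_comm (i j : Fin t) :
      PresRel (symX P i * symX P j) (symX P j * symX P i)
  /-- `x_j ^ P_j = e_{j,0,1}`. -/
  | power (j : Fin t) (h : Fin ((P j - 1) / 2)) (k : Fin (P j))
      (hh : (h : ℕ) = 0) (hk : (k : ℕ) = 0) :
      PresRel (symX P j ^ P j) (symE P (.inner j h k))
  /-- `x_j` centralizes `e_{j,0,1}`. -/
  | conj_first (j : Fin t) (h : Fin ((P j - 1) / 2)) (k : Fin (P j))
      (hh : (h : ℕ) = 0) (hk : (k : ℕ) = 0) :
      PresRel (symX P j * symE P (.inner j h k) * (symX P j)⁻¹) (symE P (.inner j h k))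
  /-- `x_j` maps `e_{j,0,k}` to `e_{j,0,k+1}` for `2 ≤ k ≤ P_j - 1`. -/
  | conj_zero (j : Fin t) (h : Fin ((P j - 1) / 2)) (k : Fin (P j))
      (hh : (h : ℕ) = 0) (hk : 1 ≤ (k : ℕ)) (hk' : (k : ℕ) + 1 < P j) :
      PresRel (symX P j * symE P (.inner j h k) * (symX P j)⁻¹)
        (symE P (.inner j h (finRotate (P j) k)))
  /-- `x_j` maps `e_{j,0,P_j}` to `e_{j,0,1}^q e_{j,0,2}⁻¹ ⋯ e_{j,0,P_j}⁻¹`. -/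
  | conj_last (j : Fin t) (h : Fin ((P j - 1) / 2)) (k k₀ : Fin (P j))
      (hh : (h : ℕ) = 0) (hk : (k : ℕ) + 1 = P j) (hk₀ : (k₀ : ℕ) = 0) :
      PresRel (symX P j * symE P (.inner j h k) * (symX P j)⁻¹)
        (symE P (.inner j h k₀) ^ order P *
          (((List.finRange (P j)).filter (fun l : Fin (P j) => decide (0 < (l : ℕ)))).map
            (fun l : Fin (P j) => (symE P (.inner j h l))⁻¹)).prod)
  /-- `x_j` maps `e_{j,h,k}` to `e_{j,h,k+1}` for `1 ≤ h`. -/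
  | conj_pos (j : Fin t) (h : Fin ((P j - 1) / 2)) (k : Fin (P j)) (hh : 1 ≤ (h : ℕ)) :
      PresRel (symX P j * symE P (.inner j h k) * (symX P j)⁻¹)
        (symE P (.inner j h (finRotate (P j) k)))
  /-- `x_a x_b` shifts the family of the pair of blocks `a < b`. -/
  | conj_cross (a b : Fin t) (hab : a < b) (k : Fin (P a * P b)) :
      PresRel (symX P a * symX P b * symE P (.cross a b hab k) * (symX P a * symX P b)⁻¹)
        (symE P (.cross a b hab (finRotate (P a * P b) k)))
  /-- `x_i` centralizes the lattice generators of the other blocks. -/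
  | conj_inner_other (i j : Fin t) (hij : i ≠ j) (h : Fin ((P j - 1) / 2)) (k : Fin (P j)) :
      PresRel (symX P i * symE P (.inner j h k) * (symX P i)⁻¹) (symE P (.inner j h k))
  /-- `x_i` centralizes the lattice generators of the pairs that do not contain `i`. -/
  | conj_cross_other (i a b : Fin t) (hab : a < b) (hia : i ≠ a) (hib : i ≠ b)
      (k : Fin (P a * P b)) :
      PresRel (symX P i * symE P (.cross a b hab k) * (symX P i)⁻¹) (symE P (.cross a b hab k))

/-- The relators `u v⁻¹` of the presentation. -/
def presRelators : Set (FreeGroup (PresGen P)) :=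
  {w | ∃ u v, PresRel P u v ∧ w = u * v⁻¹}

end Blocks

end BraidBieberbach

/-!
An element of `B_n / [P_n, P_n]` is determined by its permutation together with the signed number of
crossings of each pair of strings: the kernel of `permBar` is generated by the commuting elements
`A_{i,j}`, and `A_{i,j}` crosses only the strings `i` and `j`, twice. So every identity in
`Γ_q` can be checked on permutations and crossing functions.

The permutation of `x_j` rotates block `j` by one step. Along this rotation the letters of `δ` of
opposite signs cancel, and the crossings that remain in `x_j ^ P_j` are those of
`A_{m+1,m+2} ⋯ A_{m+P_j,m+1}`, the product over the cyclically adjacent pairs of the block. Every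
other lattice generator is `A_{x,y}^q` up to conjugation, hence crosses a single pair `2q` times.
Each pair of strings occurs for exactly one index: inside a block of odd size the orbits of the
rotation are the distances `1, …, (P_j - 1)/2`, and between the blocks `a` and `b` the Chinese
remainder theorem gives one orbit of length `P_a P_b`. This yields the independence of the lattice
generators and the relations of the presentation.

Conversely, in the presented group the lattice generators span an abelian normal subgroup, modulo
which every element is a product of powers of the `x_j`; comparing permutations and crossing
functions shows that the map to `B_n / [P_n, P_n]` is injective.
-/

namespace BraidBieberbach

/-! ### The kernel of the permutation homomorphism -/

section DescProd

variable {G : Type*} [Group G] {a b c : ℕ}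

theorem descProd_of_lt (f : ℕ → G) (h : b < a) : descProd f a b = 1 := by
  simp [descProd, show b + 1 - a = 0 by omega]

theorem descProd_succ_top (f : ℕ → G) (h : a ≤ b + 1) :
    descProd f a (b + 1) = f (b + 1) * descProd f a b := by
  unfold descProd
  rw [show b + 1 + 1 - a = (b + 1 - a) + 1 by omega, List.range'_concat]
  simp [show a + (b + 1 - a) = b + 1 by omega]

theorem descProd_mul (f : ℕ → G) (hac : a ≤ c + 1) (hcb : c ≤ b) :
    descProd f (c + 1) b * descProd f a c = descProd f a b := by
  induction b, hcb using Nat.le_induction with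
  | base => rw [descProd_of_lt f (Nat.lt_succ_self c), one_mul]
  | succ b hb ih =>
    rw [descProd_succ_top f (by omega), descProd_succ_top f (by omega : a ≤ b + 1), mul_assoc, ih]

theorem descProd_bot (f : ℕ → G) (h : a ≤ b) :
    descProd f a b = descProd f (a + 1) b * f a := by
  rw [← descProd_mul f (Nat.le_succ a) h, show descProd f a a = f a by simp [descProd]]

theorem descProd_mem (S : Subgroup G) {f : ℕ → G} (h : ∀ i, a ≤ i → i ≤ b → f i ∈ S) :
    descProd f a b ∈ S := by
  refine S.list_prod_mem fun x hx => ?_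
  obtain ⟨i, hi, rfl⟩ := List.mem_map.1 hx
  rw [List.mem_reverse, List.mem_range'_1] at hi
  exact h i hi.1 (by omega)

theorem commute_descProd {g : G} {f : ℕ → G} (h : ∀ i, a ≤ i → i ≤ b → Commute g (f i)) :
    Commute g (descProd f a b) :=
  (Subgroup.mem_centralizer_singleton_iff.1
    (descProd_mem (.centralizer {g}) fun i hi hi' =>
      Subgroup.mem_centralizer_singleton_iff.2 (h i hi hi').eq.symm)).symm

end DescProd

section Coxeter

variable {G : Type*} [Group G]

/-- `s 1, …, s (n - 1)` satisfy the braid relations on `n` strings. -/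
structure IsBraidSeq (n : ℕ) (s : ℕ → G) : Prop where
  comm : ∀ i j, 1 ≤ i → i + 2 ≤ j → j < n → Commute (s i) (s j)
  braid : ∀ i, 1 ≤ i → i + 1 < n → s (i + 1) * s i * s (i + 1) = s i * s (i + 1) * s i

/-- Under `p`, the elements `s 1, …, s (n - 1)` act on `Fin n` as the adjacent transpositions.
Positions are counted from `0`, so `s i` exchanges `i - 1` and `i`. -/
def ActsByAdjSwaps {n : ℕ} (p : G →* Equiv.Perm (Fin n)) (s : ℕ → G) : Prop :=
  ∀ i (hi : 1 ≤ i) (hin : i < n), p (s i) = adjSwap n ⟨i - 1, by omega⟩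

/-- The standard parabolic subgroup generated by `s 1, …, s (m - 1)`. -/
def parabolic (s : ℕ → G) (m : ℕ) : Subgroup G :=
  Subgroup.closure (s '' Set.Ico 1 m)

variable {n : ℕ} {s : ℕ → G} {p : G →* Equiv.Perm (Fin n)}

theorem mem_parabolic {m i : ℕ} (hi : 1 ≤ i) (him : i < m) : s i ∈ parabolic s m :=
  Subgroup.subset_closure ⟨i, ⟨hi, him⟩, rfl⟩

theorem IsBraidSeq.map {H : Type*} [Group H] (hs : IsBraidSeq n s) (f : G →* H) :
    IsBraidSeq n (f ∘ s) where
  comm i j hi hij hj := (hs.comm i j hi hij hj).map f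
  braid i hi hin := by
    simpa only [map_mul, Function.comp_apply] using congrArg f (hs.braid i hi hin)

theorem IsBraidSeq.commute (hs : IsBraidSeq n s) {i j : ℕ} (hi : 1 ≤ i) (hj : 1 ≤ j) (hin : i < n)
    (hjn : j < n) (h : i + 2 ≤ j ∨ j + 2 ≤ i) : Commute (s i) (s j) :=
  h.elim (hs.comm i j hi · hjn) fun h => (hs.comm j i hj h hin).symm

theorem IsBraidSeq.descProd_mul_succ (hs : IsBraidSeq n s) {a b i : ℕ} (ha : 1 ≤ a) (hi : a ≤ i)
    (hib : i < b) (hb : b < n) : descProd s a b * s (i + 1) = s i * descProd s a b := by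
  obtain ⟨i, rfl⟩ : ∃ k, i = k + 1 := ⟨i - 1, by omega⟩
  rw [← descProd_mul s (c := i + 2) (by omega) hib, descProd_succ_top s (by omega),
    descProd_succ_top s (by omega)]
  have h_low : Commute (descProd s a i) (s (i + 2)) :=
    (commute_descProd fun j _ _ => hs.commute (by omega) (by omega) (by omega) (by omega)
      (by omega)).symm
  have h_high : Commute (descProd s (i + 2 + 1) b) (s (i + 1)) :=
    (commute_descProd fun j _ _ => hs.commute (by omega) (by omega) (by omega) (by omega)
      (by omega)).symm
  have h_braid : s (i + 2) * s (i + 1) * s (i + 2) = s (i + 1) * s (i + 2) * s (i + 1) :=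
    hs.braid (i + 1) (by omega) (by omega)
  generalize descProd s a i = x at *
  generalize descProd s (i + 2 + 1) b = y at *
  calc y * (s (i + 2) * (s (i + 1) * x)) * s (i + 2)
      = y * s (i + 2) * s (i + 1) * (x * s (i + 2)) := by simp only [mul_assoc]
    _ = y * (s (i + 2) * s (i + 1) * s (i + 2)) * x := by simp only [h_low.eq, mul_assoc]
    _ = y * s (i + 1) * s (i + 2) * s (i + 1) * x := by simp only [h_braid, mul_assoc]
    _ = s (i + 1) * (y * (s (i + 2) * (s (i + 1) * x))) := by simp only [h_high.eq, mul_assoc]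

theorem ActsByAdjSwaps.val_apply (hp : ActsByAdjSwaps p s) {i : ℕ} (hi : 1 ≤ i) (hin : i < n)
    (x : Fin n) :
    (p (s i) x : ℕ) = if (x : ℕ) = i - 1 then i else if (x : ℕ) = i then i - 1 else x := by
  rw [hp i hi hin, adjSwap, Equiv.swap_apply_def]
  simp only [Fin.ext_iff]
  split_ifs <;> (try simp only) <;> omega

theorem ActsByAdjSwaps.val_descProd_apply (hp : ActsByAdjSwaps p s) {a b : ℕ}
    (ha : 1 ≤ a) (hab : a ≤ b + 1) (hb : b < n) (x : Fin n) :
    (p (descProd s a b) x : ℕ) =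
      if (x : ℕ) = a - 1 then b else if a ≤ (x : ℕ) ∧ (x : ℕ) ≤ b then (x : ℕ) - 1 else x := by
  have hab' : a - 1 ≤ b := by omega
  induction b, hab' using Nat.le_induction with
  | base =>
    rw [descProd_of_lt s (by omega), map_one, Equiv.Perm.one_apply]
    split_ifs <;> omega
  | succ b _ ih =>
    rw [descProd_succ_top s (by omega), map_mul, Equiv.Perm.mul_apply, hp.val_apply (by omega) hb,
      ih (by omega) (by omega)]
    split_ifs <;> omega

theorem ActsByAdjSwaps.apply_eq_self_of_mem_parabolic (hp : ActsByAdjSwaps p s) {m : ℕ} {g : G}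
    (hg : g ∈ parabolic s m) {x : Fin n} (hx : m ≤ (x : ℕ)) : p g x = x := by
  suffices parabolic s m ≤ (MulAction.stabilizer (Equiv.Perm (Fin n)) x).comap p from this hg
  rw [parabolic, Subgroup.closure_le]
  rintro _ ⟨i, ⟨hi, him⟩, rfl⟩
  refine MulAction.mem_stabilizer_iff.2 (Fin.ext ?_)
  rw [Equiv.Perm.smul_def, hp.val_apply hi (by omega)]
  split_ifs <;> omega

theorem IsBraidSeq.exists_descProd_mul_eq (hs : IsBraidSeq n s)
    (hsq : ∀ i, 1 ≤ i → i < n → s i * s i = 1) {m k i : ℕ} (hmn : m < n) (hk : 1 ≤ k)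
    (hkm : k ≤ m + 1) (hi : 1 ≤ i) (him : i ≤ m) :
    ∃ u ∈ parabolic s m, ∃ l, 1 ≤ l ∧ l ≤ m + 1 ∧ descProd s k m * s i = u * descProd s l m := by
  rcases lt_trichotomy (i + 1) k with h | rfl | h
  · refine ⟨s i, mem_parabolic hi (by omega), k, hk, hkm, ?_⟩
    exact (commute_descProd fun j _ _ =>
      hs.commute hi (by omega) (by omega) (by omega) (by omega)).eq.symm
  · exact ⟨1, one_mem _, i, hi, by omega, by rw [one_mul, descProd_bot s him]⟩
  rcases (Nat.lt_succ_iff.1 h).eq_or_lt with rfl | h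
  · refine ⟨1, one_mem _, k + 1, by omega, by omega, ?_⟩
    rw [descProd_bot s him, mul_assoc, hsq k hi (by omega), one_mul, mul_one]
  · obtain ⟨i, rfl⟩ : ∃ j, i = j + 1 := ⟨i - 1, by omega⟩
    exact ⟨s i, mem_parabolic (by omega) (by omega), k, hk, hkm,
      hs.descProd_mul_succ hk (by omega) him hmn⟩

theorem IsBraidSeq.exists_eq_mul_descProd (hs : IsBraidSeq n s)
    (hsq : ∀ i, 1 ≤ i → i < n → s i * s i = 1) {m : ℕ} (hmn : m < n) {g : G}
    (hg : g ∈ parabolic s (m + 1)) :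
    ∃ u ∈ parabolic s m, ∃ k, 1 ≤ k ∧ k ≤ m + 1 ∧ g = u * descProd s k m := by
  have mul_gen : ∀ g : G, ∀ i ∈ Set.Ico 1 (m + 1),
      (∃ u ∈ parabolic s m, ∃ k, 1 ≤ k ∧ k ≤ m + 1 ∧ g = u * descProd s k m) →
      ∃ u ∈ parabolic s m, ∃ k, 1 ≤ k ∧ k ≤ m + 1 ∧ g * s i = u * descProd s k m := by
    rintro _ i ⟨hi, him⟩ ⟨u, hu, k, hk, hkm, rfl⟩
    obtain ⟨v, hv, l, hl, hlm, h⟩ :=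
      hs.exists_descProd_mul_eq hsq hmn hk hkm hi (Nat.lt_succ_iff.1 him)
    exact ⟨u * v, mul_mem hu hv, l, hl, hlm, by rw [mul_assoc, h, mul_assoc]⟩
  induction hg using Subgroup.closure_induction_right with
  | one =>
    exact ⟨1, one_mem _, m + 1, by omega, le_rfl, by rw [descProd_of_lt s (by omega), one_mul]⟩
  | mul_right x _ y hy ih =>
    obtain ⟨i, hi, rfl⟩ := hy
    exact mul_gen x i hi ih
  | mul_inv_cancel x _ y hy ih =>
    obtain ⟨i, hi, rfl⟩ := hy
    rw [inv_eq_of_mul_eq_one_right (hsq i hi.1 (hi.2.trans_le hmn))]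
    exact mul_gen x i hi ih

/-- In the normal form `u * s m ⋯ s k` the image of `k - 1` is `m`, so a trivial permutation forces
`k = m + 1` and the last factor is empty. -/
theorem IsBraidSeq.eq_one_of_perm_eq_one (hs : IsBraidSeq n s)
    (hsq : ∀ i, 1 ≤ i → i < n → s i * s i = 1) (hp : ActsByAdjSwaps p s) {m : ℕ} (hmn : m ≤ n)
    {g : G} (hg : g ∈ parabolic s m) (hpg : p g = 1) : g = 1 := by
  induction m generalizing g with
  | zero => simpa [parabolic] using hg
  | succ m ih =>
    obtain ⟨u, hu, k, hk, hkm, rfl⟩ := hs.exists_eq_mul_descProd hsq hmn hg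
    have h_image : (p (descProd s k m) ⟨k - 1, by omega⟩ : ℕ) = m := by
      rw [hp.val_descProd_apply hk hkm hmn, if_pos rfl]
    have h_fixed := congrArg Fin.val (DFunLike.congr_fun hpg (⟨k - 1, by omega⟩ : Fin n))
    rw [map_mul, Equiv.Perm.mul_apply, hp.apply_eq_self_of_mem_parabolic hu h_image.ge, h_image,
      Equiv.Perm.one_apply] at h_fixed
    obtain rfl : k = m + 1 := by simp only at h_fixed; omega
    rw [descProd_of_lt s (by omega), mul_one] at hpg ⊢
    exact ih (by omega) hu hpg

end Coxeter

theorem normal_closure_of_conj_mem {G : Type*} [Group G] {S T : Set G}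
    (hT : Subgroup.closure T = ⊤)
    (hconj : ∀ g ∈ T, ∀ x ∈ S, g * x * g⁻¹ ∈ Subgroup.closure S)
    (hpow : ∀ g ∈ T, ∃ k : ℕ, g ^ (k + 1) ∈ Subgroup.closure S) :
    (Subgroup.closure S).Normal := by
  set N := Subgroup.closure S
  let M : Submonoid G :=
    { carrier := {g | ∀ x ∈ N, g * x * g⁻¹ ∈ N}
      one_mem' := fun x hx => by simpa using hx
      mul_mem' := fun {g h} hg hh x hx => by simpa [mul_assoc] using hg _ (hh x hx) }
  have hNM : N.toSubmonoid ≤ M := fun g hg x hx => mul_mem (mul_mem hg hx) (inv_mem hg)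
  have hTM : T ⊆ M := fun g hg =>
    show N ≤ N.comap (MulAut.conj g).toMonoidHom from (Subgroup.closure_le _).2 (hconj g hg)
  have hTM' : T⁻¹ ⊆ M := by
    intro g hg
    obtain ⟨k, hk⟩ := hpow g⁻¹ hg
    have : g = (g⁻¹ ^ (k + 1))⁻¹ * g⁻¹ ^ k := by rw [pow_succ']; group
    rw [this]
    exact mul_mem (hNM (N.inv_mem hk)) (pow_mem (hTM hg) k)
  have hM : ⊤ ≤ M := by
    rw [← Subgroup.top_toSubmonoid, ← hT, Subgroup.closure_toSubmonoid, Submonoid.closure_le]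
    exact Set.union_subset hTM hTM'
  exact ⟨fun x hx g => hM (Submonoid.mem_top g) x hx⟩

section PureBraid

variable {n : ℕ}

theorem sig_eq {i : ℕ} (hi : 1 ≤ i) (hin : i < n) :
    sig n i = QuotientGroup.mk (PresentedGroup.of (⟨i - 1, by omega⟩ : Fin (n - 1))) :=
  dif_pos ⟨hi, hin⟩

theorem isBraidSeq_sig : IsBraidSeq n (sig n) where
  comm i j hi hij hj := by
    rw [sig_eq hi (by omega), sig_eq (by omega) hj]
    exact congrArg (QuotientGroup.mk' ⁅pureBraid n, pureBraid n⁆)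
      (PresentedGroup.mk_eq_mk_of_mul_inv_mem (rels := braidRelators n)
        (.inl ⟨⟨i - 1, by omega⟩, ⟨j - 1, by omega⟩, by simp only; omega, rfl⟩))
  braid i hi hin := by
    rw [sig_eq hi (by omega), sig_eq (by omega) hin]
    exact congrArg (QuotientGroup.mk' ⁅pureBraid n, pureBraid n⁆)
      (PresentedGroup.mk_eq_mk_of_mul_inv_mem (rels := braidRelators n)
        (.inr ⟨⟨i - 1, by omega⟩, ⟨i + 1 - 1, by omega⟩, by simp only; omega, rfl⟩))

theorem actsByAdjSwaps_permBar : ActsByAdjSwaps (permBar n) (sig n) := by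
  intro i hi hin
  rw [sig_eq hi hin]
  exact PresentedGroup.toGroup.of (adjSwap_relators n)

theorem parabolic_sig : parabolic (sig n) n = ⊤ := by
  refine eq_top_iff.2 fun g _ => ?_
  obtain ⟨b, rfl⟩ := QuotientGroup.mk_surjective g
  refine PresentedGroup.generated_by (braidRelators n)
    ((parabolic (sig n) n).comap (QuotientGroup.mk' ⁅pureBraid n, pureBraid n⁆)) (fun j => ?_) b
  have := mem_parabolic (s := sig n) (m := n) (i := j + 1) (by omega) (by omega)
  rwa [sig_eq (by omega) (by omega)] at this

theorem commute_of_permBar_eq_one {g h : BraidQuot n} (hg : permBar n g = 1)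
    (hh : permBar n h = 1) : Commute g h := by
  obtain ⟨a, rfl⟩ := QuotientGroup.mk_surjective g
  obtain ⟨b, rfl⟩ := QuotientGroup.mk_surjective h
  rw [← commutatorElement_eq_one_iff_commute]
  exact (QuotientGroup.eq_one_iff _).2 (Subgroup.commutator_mem_commutator hg hh)

theorem permBar_pureGen {i j : ℕ} (hi : 1 ≤ i) (hin : i < n) : permBar n (pureGen n i j) = 1 := by
  rw [pureGen, map_mul, map_mul, map_pow, actsByAdjSwaps_permBar i hi hin, adjSwap, pow_two,
    Equiv.swap_mul_self, mul_one, map_inv, mul_inv_cancel]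

theorem pureGen_succ_self (i : ℕ) : pureGen n i (i + 1) = sig n i ^ 2 := by
  simp [pureGen, descProd_of_lt]

theorem pureGen_succ {i j : ℕ} (hij : i < j) :
    pureGen n i (j + 1) = sig n j * pureGen n i j * (sig n j)⁻¹ := by
  obtain ⟨k, rfl⟩ : ∃ k, j = k + 1 := ⟨j - 1, by omega⟩
  simp only [pureGen, Nat.add_sub_cancel]
  rw [descProd_succ_top _ (by omega)]
  group

theorem conj_sig_pureGen {i j : ℕ} (hi : 1 ≤ i) (hij : i + 1 < j) (hj : j ≤ n) :
    sig n i * pureGen n i j * (sig n i)⁻¹ = pureGen n (i + 1) j := by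
  obtain ⟨k, rfl⟩ : ∃ k, j = k + 1 := ⟨j - 1, by omega⟩
  simp only [pureGen, Nat.add_sub_cancel]
  rw [descProd_bot _ (by omega : i + 1 ≤ k)]
  have h_comm : Commute (sig n i) (descProd (sig n) (i + 1 + 1) k) :=
    commute_descProd fun l _ _ => isBraidSeq_sig.commute (by omega) (by omega) (by omega)
      (by omega) (by omega)
  have h_braid := isBraidSeq_sig (n := n).braid i hi (by omega)
  generalize descProd (sig n) (i + 1 + 1) k = d at *
  generalize sig n i = a at *
  generalize sig n (i + 1) = b at *
  have h_sq : a * b * a ^ 2 = b ^ 2 * (a * b) := by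
    calc a * b * a ^ 2 = b * a * b * a := by rw [h_braid]; simp only [pow_two, mul_assoc]
      _ = b * (a * b * a) := by simp only [mul_assoc]
      _ = b ^ 2 * (a * b) := by rw [← h_braid]; simp only [pow_two, mul_assoc]
  calc a * (d * b * a ^ 2 * (d * b)⁻¹) * a⁻¹ = (a * d) * b * a ^ 2 * b⁻¹ * (a * d)⁻¹ := by group
    _ = d * (a * b * a ^ 2) * b⁻¹ * (a * d)⁻¹ := by rw [h_comm.eq]; group
    _ = d * b ^ 2 * d⁻¹ := by rw [h_sq, h_comm.eq]; group

theorem commute_sig_pureGen {i j k : ℕ} (hi : 1 ≤ i) (hij : i < j) (hj : j ≤ n) (hk : 1 ≤ k)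
    (hkn : k < n) (h : k + 1 < i ∨ j < k ∨ (i < k ∧ k + 1 < j)) :
    Commute (sig n k) (pureGen n i j) := by
  have h_far : ∀ l, 1 ≤ l → l < n → (k + 2 ≤ l ∨ l + 2 ≤ k) → Commute (sig n k) (sig n l) :=
    fun l hl hln h => isBraidSeq_sig.commute hk hl hkn hln h
  unfold pureGen
  rcases (or_assoc.2 h : (k + 1 < i ∨ j < k) ∨ _) with h | ⟨h, h'⟩
  · have hd : Commute (sig n k) (descProd (sig n) (i + 1) (j - 1)) :=
      commute_descProd fun l _ _ => h_far l (by omega) (by omega) (by omega)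
    exact (hd.mul_right ((h_far i hi (by omega) (by omega)).pow_right 2)).mul_right hd.inv_right
  · have hd := isBraidSeq_sig (n := n).descProd_mul_succ (a := i + 1) (b := j - 1) (i := k)
      (by omega) (by omega) (by omega) (by omega)
    have h_comm : Commute (sig n (k + 1)) (sig n i) :=
      isBraidSeq_sig.commute (by omega) hi (by omega) (by omega) (by omega)
    rw [← mul_inv_eq_iff_eq_mul.2 hd]
    exact (h_comm.pow_right 2).conj _

variable (n) in
/-- The set of the standard pure braid generators `A_{i,j}`, `1 ≤ i < j ≤ n`. -/
def pureGens : Set (BraidQuot n) :=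
  {g | ∃ i j, 1 ≤ i ∧ i < j ∧ j ≤ n ∧ g = pureGen n i j}

theorem pureGen_mem_closure {i j : ℕ} (hi : 1 ≤ i) (hij : i < j) (hj : j ≤ n) :
    pureGen n i j ∈ Subgroup.closure (pureGens n) :=
  Subgroup.subset_closure ⟨i, j, hi, hij, hj, rfl⟩

theorem sig_sq_mem_closure {i : ℕ} (hi : 1 ≤ i) (hin : i < n) :
    sig n i ^ 2 ∈ Subgroup.closure (pureGens n) := by
  rw [← pureGen_succ_self]
  exact pureGen_mem_closure hi (by omega) (by omega)

theorem conj_sig_pureGen_mem_closure {i j k : ℕ} (hi : 1 ≤ i) (hij : i < j) (hj : j ≤ n)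
    (hk : 1 ≤ k) (hkn : k < n) :
    sig n k * pureGen n i j * (sig n k)⁻¹ ∈ Subgroup.closure (pureGens n) := by
  have h_sq := sig_sq_mem_closure hk hkn
  have h_twice : ∀ {g}, g ∈ Subgroup.closure (pureGens n) →
      sig n k * (sig n k * g * (sig n k)⁻¹) * (sig n k)⁻¹ ∈ Subgroup.closure (pureGens n) := by
    intro g hg
    have : sig n k * (sig n k * g * (sig n k)⁻¹) * (sig n k)⁻¹ =
        sig n k ^ 2 * g * (sig n k ^ 2)⁻¹ := by rw [pow_two]; group
    rw [this]
    exact mul_mem (mul_mem h_sq hg) (inv_mem h_sq)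
  by_cases h : k + 1 < i ∨ j < k ∨ (i < k ∧ k + 1 < j)
  · rw [(commute_sig_pureGen hi hij hj hk hkn h).eq, mul_inv_cancel_right]
    exact pureGen_mem_closure hi hij hj
  obtain rfl | ⟨rfl, rfl⟩ | ⟨rfl, h'⟩ | ⟨rfl, h'⟩ | rfl :
      k = j ∨ (i = k ∧ j = k + 1) ∨ (i = k ∧ k + 1 < j) ∨ (j = k + 1 ∧ i < k) ∨ i = k + 1 := by
    omega
  · rw [← pureGen_succ hij]
    exact pureGen_mem_closure hi (by omega) hkn
  · rw [pureGen_succ_self, ← pow_succ', pow_succ, mul_inv_cancel_right]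
    exact h_sq
  · rw [conj_sig_pureGen hi h' hj]
    exact pureGen_mem_closure (by omega) h' hj
  · rw [pureGen_succ h']
    exact h_twice (pureGen_mem_closure hi h' hkn.le)
  · rw [← conj_sig_pureGen hk hij hj]
    exact h_twice (pureGen_mem_closure hk (by omega) hj)

instance normal_closure_pureGens : (Subgroup.closure (pureGens n)).Normal := by
  refine normal_closure_of_conj_mem parabolic_sig ?_ ?_
  · rintro _ ⟨k, ⟨hk, hkn⟩, rfl⟩ _ ⟨i, j, hi, hij, hj, rfl⟩
    exact conj_sig_pureGen_mem_closure hi hij hj hk hkn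
  · rintro _ ⟨k, ⟨hk, hkn⟩, rfl⟩
    exact ⟨1, sig_sq_mem_closure hk hkn⟩

theorem closure_pureGens_le_ker : Subgroup.closure (pureGens n) ≤ (permBar n).ker := by
  rw [Subgroup.closure_le]
  rintro _ ⟨i, j, hi, hij, hj, rfl⟩
  exact permBar_pureGen hi (by omega)

theorem ker_permBar : (permBar n).ker = Subgroup.closure (pureGens n) := by
  refine le_antisymm (fun g hg => ?_) closure_pureGens_le_ker
  let mk := QuotientGroup.mk' (Subgroup.closure (pureGens n))
  have hsq : ∀ i, 1 ≤ i → i < n → mk (sig n i) * mk (sig n i) = 1 := fun i hi hin => by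
    rw [← map_mul, ← pow_two]
    exact (QuotientGroup.eq_one_iff _).2 (sig_sq_mem_closure hi hin)
  have hmem : mk g ∈ parabolic (mk ∘ sig n) n := by
    rw [parabolic, Set.image_comp, ← MonoidHom.map_closure]
    refine Subgroup.mem_map_of_mem mk ?_
    rw [← parabolic, parabolic_sig]
    trivial
  exact (QuotientGroup.eq_one_iff g).1 <| (isBraidSeq_sig.map mk).eq_one_of_perm_eq_one hsq
    (p := QuotientGroup.lift _ (permBar n) closure_pureGens_le_ker)
    actsByAdjSwaps_permBar le_rfl hmem hg

end PureBraid

/-! ### Crossing functions -/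

section PowHom

variable {ι G : Type*} [Group G]

theorem pairwise_commute_zpowersHom {v : ι → G} (hv : ∀ i j, Commute (v i) (v j)) :
    Pairwise fun i j => ∀ x y, Commute (zpowersHom G (v i) x) (zpowersHom G (v j) y) :=
  fun i j _ x y => (hv i j).zpow_zpow x.toAdd y.toAdd

variable [Fintype ι]

/-- The homomorphism `f ↦ ∏ i, v i ^ f i` of a commuting family `v`. -/
noncomputable def powHom (v : ι → G) (hv : ∀ i j, Commute (v i) (v j)) :
    (ι → Multiplicative ℤ) →* G :=
  MonoidHom.noncommPiCoprod (fun i => zpowersHom G (v i)) (pairwise_commute_zpowersHom hv)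

variable {v : ι → G} {hv : ∀ i j, Commute (v i) (v j)}

theorem powHom_mulSingle [DecidableEq ι] (i : ι) (m : Multiplicative ℤ) :
    powHom v hv (Pi.mulSingle i m) = v i ^ m.toAdd :=
  MonoidHom.noncommPiCoprod_mulSingle ..

theorem powHom_apply {H : Type*} [CommGroup H] (v : ι → H) (f : ι → Multiplicative ℤ) :
    powHom v (fun _ _ => Commute.all _ _) f = ∏ i, v i ^ (f i).toAdd := by
  rw [powHom, MonoidHom.noncommPiCoprod_apply, Finset.noncommProd_eq_prod]
  rfl

theorem range_powHom : (powHom v hv).range = Subgroup.closure (Set.range v) := by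
  rw [powHom, MonoidHom.noncommPiCoprod_range, Set.range_eq_iUnion, Subgroup.closure_iUnion]
  exact iSup_congr fun i => (Subgroup.zpowers_eq_closure (v i) ▸ rfl)

theorem powHom_mem {H : Subgroup G} {f : ι → Multiplicative ℤ}
    (h : ∀ i, v i ^ (f i).toAdd ∈ H) : powHom v hv f ∈ H := by
  rw [powHom, MonoidHom.noncommPiCoprod_apply]
  exact H.noncommProd_mem _ fun i _ => h i

theorem map_powHom {H : Type*} [Group H] (φ : G →* H) {w : ι → H}
    (hw : ∀ i j, Commute (w i) (w j)) (h : ∀ i, φ (v i) = w i) (f : ι → Multiplicative ℤ) :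
    φ (powHom v hv f) = powHom w hw f := by
  classical
  refine DFunLike.congr_fun (f := φ.comp (powHom v hv)) (g := powHom w hw) ?_ f
  refine MonoidHom.pi_ext fun i m => ?_
  rw [MonoidHom.comp_apply, powHom_mulSingle, powHom_mulSingle, map_zpow, h]

end PowHom

theorem linearIndependent_of_triangular {ι κ R : Type*} [Ring R] [NoZeroDivisors R]
    {v : ι → κ → R} (e : ι → κ) (rank : ι → ℕ) (hdiag : ∀ i, v i (e i) ≠ 0)
    (hoff : ∀ i j, i ≠ j → rank j ≤ rank i → v i (e j) = 0) : LinearIndependent R v := by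
  refine linearIndependent_iff'.2 fun s c hc j hj => ?_
  induction h : rank j using Nat.strong_induction_on generalizing j with
  | _ m ih =>
    have h_eval : ∑ i ∈ s, c i * v i (e j) = 0 := by
      simpa only [Finset.sum_apply, Pi.smul_apply, smul_eq_mul, Pi.zero_apply] using
        congrFun hc (e j)
    rw [Finset.sum_eq_single j (fun i hi hij => ?_) (absurd hj)] at h_eval
    · exact (mul_eq_zero.1 h_eval).resolve_right (hdiag j)
    · rcases lt_or_ge (rank i) (rank j) with hlt | hle
      · rw [ih _ (h ▸ hlt) i hi rfl, zero_mul]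
      · rw [hoff i j hij hle, mul_zero]

section PairModel

variable {α : Type*}

/-- The action of permutations on integral functions of unordered pairs. -/
def act : Equiv.Perm α →* (Sym2 α → ℤ) ≃ₗ[ℤ] (Sym2 α → ℤ) where
  toFun g :=
    { toFun := fun f s => f (s.map g.symm)
      invFun := fun f s => f (s.map g)
      map_add' := fun _ _ => rfl
      map_smul' := fun _ _ => rfl
      left_inv := fun f => by ext s; simp [Sym2.map_map]
      right_inv := fun f => by ext s; simp [Sym2.map_map] }
  map_one' := by
    ext f s
    exact congrArg f (congrFun Sym2.map_id s)
  map_mul' g h := by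
    ext f s
    exact congrArg f (Sym2.map_map (g := h.symm) (f := g.symm) s).symm

/-- `act`, as an action on the multiplicative copy of the group of functions. -/
def actMulAut : Equiv.Perm α →* MulAut (Multiplicative (Sym2 α → ℤ)) where
  toFun g := AddEquiv.toMultiplicative (act g).toAddEquiv
  map_one' := by rw [map_one]; rfl
  map_mul' g h := by rw [map_mul]; rfl

variable (α) in
/-- The semidirect product in which `B_n / [P_n, P_n]` embeds, for `α = Fin n`. -/
abbrev PairModel : Type _ :=
  Multiplicative (Sym2 α → ℤ) ⋊[actMulAut] Equiv.Perm α

theorem commute_of_right_eq_one {N G : Type*} [CommGroup N] [Group G] {φ : G →* MulAut N}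
    {a b : N ⋊[φ] G} (ha : a.right = 1) (hb : b.right = 1) : Commute a b := by
  refine SemidirectProduct.ext ?_ (by simp [ha, hb])
  simp [ha, hb, mul_comm]

variable [DecidableEq α]

/-- The characteristic function of a pair. -/
def edge (s : Sym2 α) : Sym2 α → ℤ := Pi.single s 1

theorem edge_apply (s u : Sym2 α) : edge s u = if u = s then 1 else 0 := Pi.single_apply ..

theorem act_edge (g : Equiv.Perm α) (x y : α) : act g (edge s(x, y)) = edge s(g x, g y) := by
  funext u
  change edge s(x, y) (u.map g.symm) = _
  have : u.map g.symm = s(x, y) ↔ u = s(g x, g y) := by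
    rw [← (Sym2.map.injective g.injective).eq_iff, Sym2.map_map]
    simp
  simp only [edge_apply, this]

/-- The transposition of `x` and `y`, together with one crossing of this pair. -/
def crossingSwap (x y : α) : PairModel α :=
  ⟨Multiplicative.ofAdd (edge s(x, y)), Equiv.swap x y⟩

theorem crossingSwap_mul_left (x y : α) (g : PairModel α) :
    (crossingSwap x y * g).left.toAdd = edge s(x, y) + act (Equiv.swap x y) g.left.toAdd := rfl

theorem crossingSwap_commute {x y z w : α} (hxy : x ≠ y) (hzw : z ≠ w) (hxz : x ≠ z)
    (hxw : x ≠ w) (hyz : y ≠ z) (hyw : y ≠ w) : Commute (crossingSwap x y) (crossingSwap z w) := by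
  refine SemidirectProduct.ext ?_ ?_
  · refine Multiplicative.toAdd.injective ?_
    simp only [crossingSwap_mul_left]
    simp only [crossingSwap, toAdd_ofAdd, act_edge]
    rw [Equiv.swap_apply_of_ne_of_ne hxz.symm hyz.symm,
      Equiv.swap_apply_of_ne_of_ne hxw.symm hyw.symm, Equiv.swap_apply_of_ne_of_ne hxz hxw,
      Equiv.swap_apply_of_ne_of_ne hyz hyw, add_comm]
  · exact (Equiv.Perm.disjoint_swap_swap (by simp [*])).commute

theorem crossingSwap_braid {x y z : α} (hxy : x ≠ y) (hxz : x ≠ z) (hyz : y ≠ z) :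
    crossingSwap y z * crossingSwap x y * crossingSwap y z =
      crossingSwap x y * crossingSwap y z * crossingSwap x y := by
  rw [mul_assoc, mul_assoc]
  refine SemidirectProduct.ext ?_ ?_
  · refine Multiplicative.toAdd.injective ?_
    simp only [crossingSwap_mul_left, map_add]
    simp only [crossingSwap, toAdd_ofAdd, act_edge, Equiv.swap_apply_left, Equiv.swap_apply_right,
      Equiv.swap_apply_of_ne_of_ne hxy hxz, Equiv.swap_apply_of_ne_of_ne hxz.symm hyz.symm]
    abel
  · change Equiv.swap y z * (Equiv.swap x y * Equiv.swap y z) =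
      Equiv.swap x y * (Equiv.swap y z * Equiv.swap x y)
    rw [← mul_assoc, ← mul_assoc, Equiv.swap_mul_swap_mul_swap hxy hxz, Equiv.swap_comm x y,
      Equiv.swap_comm y z, Equiv.swap_mul_swap_mul_swap hyz.symm hxz.symm, Equiv.swap_comm]

variable {n : ℕ}

/-- The image of the standard generators of the braid group in the pair model. -/
def modelGen (n : ℕ) (i : Fin (n - 1)) : PairModel (Fin n) :=
  crossingSwap ⟨i, by omega⟩ ⟨i + 1, by omega⟩

theorem lift_modelGen_eq_one (n : ℕ) :
    ∀ w ∈ braidRelators n, FreeGroup.lift (modelGen n) w = 1 := by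
  rintro w (⟨i, j, hij, rfl⟩ | ⟨i, j, hij, rfl⟩)
  all_goals
    rw [map_mul, map_inv, mul_inv_eq_one]
    simp only [map_mul, FreeGroup.lift_apply_of, modelGen]
  · apply crossingSwap_commute <;> simp only [ne_eq, Fin.mk.injEq] <;> omega
  · simp only [hij]
    apply crossingSwap_braid <;> simp only [ne_eq, Fin.mk.injEq] <;> omega

variable (n) in
/-- The representation of the braid group in the pair model. -/
def braidModelHom : BraidGroup n →* PairModel (Fin n) :=
  PresentedGroup.toGroup (lift_modelGen_eq_one n)

theorem rightHom_comp_braidModelHom :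
    SemidirectProduct.rightHom.comp (braidModelHom n) = braidPerm n := by
  refine PresentedGroup.ext fun i => ?_
  rw [MonoidHom.comp_apply, braidModelHom, braidPerm, PresentedGroup.toGroup.of,
    PresentedGroup.toGroup.of]
  rfl

theorem commutator_pureBraid_le_ker : ⁅pureBraid n, pureBraid n⁆ ≤ (braidModelHom n).ker := by
  have h_right : ∀ a ∈ pureBraid n, (braidModelHom n a).right = 1 := fun a ha =>
    (DFunLike.congr_fun rightHom_comp_braidModelHom a).trans ha
  refine Subgroup.commutator_le.2 fun a ha b hb => ?_
  rw [MonoidHom.mem_ker, map_commutatorElement, commutatorElement_eq_one_iff_commute]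
  exact commute_of_right_eq_one (h_right a ha) (h_right b hb)

variable (n) in
/-- The homomorphism from `B_n / [P_n, P_n]` to the pair model induced by `braidModelHom`. -/
def modelHom : BraidQuot n →* PairModel (Fin n) :=
  QuotientGroup.lift _ (braidModelHom n) commutator_pureBraid_le_ker

theorem modelHom_right (g : BraidQuot n) : (modelHom n g).right = permBar n g := by
  obtain ⟨b, rfl⟩ := QuotientGroup.mk_surjective g
  exact DFunLike.congr_fun rightHom_comp_braidModelHom b

end PairModel

section Crossings

variable {n : ℕ}

/-- The crossed homomorphism which counts, with signs, the crossings of each pair of strings. -/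
def crossing (g : BraidQuot n) : Sym2 (Fin n) → ℤ :=
  (modelHom n g).left.toAdd

theorem crossing_one : crossing (1 : BraidQuot n) = 0 := by
  rw [crossing, map_one]
  rfl

theorem crossing_mul (g h : BraidQuot n) :
    crossing (g * h) = crossing g + act (permBar n g) (crossing h) := by
  rw [crossing, map_mul, SemidirectProduct.mul_left, modelHom_right]
  rfl

theorem act_permBar_inv_crossing (g : BraidQuot n) :
    act (permBar n g) (crossing g⁻¹) = -crossing g := by
  rw [eq_neg_iff_add_eq_zero, add_comm, ← crossing_mul, mul_inv_cancel, crossing_one]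

theorem crossing_conj (g : BraidQuot n) {a : BraidQuot n} (ha : permBar n a = 1) :
    crossing (g * a * g⁻¹) = act (permBar n g) (crossing a) := by
  rw [crossing_mul, crossing_mul, map_mul, ha, mul_one, act_permBar_inv_crossing]
  abel

theorem permBar_conj (g : BraidQuot n) {a : BraidQuot n} (ha : permBar n a = 1) :
    permBar n (g * a * g⁻¹) = 1 :=
  (permBar n).normal_ker.conj_mem a ha g

theorem crossing_pow (g : BraidQuot n) (k : ℕ) :
    crossing (g ^ k) = ∑ i ∈ Finset.range k, act (permBar n g ^ i) (crossing g) := by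
  induction k with
  | zero => rw [pow_zero, crossing_one, Finset.range_zero, Finset.sum_empty]
  | succ k ih => rw [pow_succ, crossing_mul, ih, Finset.sum_range_succ, map_pow]

variable (n) in
/-- The crossing function as a homomorphism on the image of the pure braid group. -/
def pureCrossing : (permBar n).ker →* Multiplicative (Sym2 (Fin n) → ℤ) where
  toFun g := .ofAdd (crossing g.1)
  map_one' := crossing_one
  map_mul' g h := congrArg Multiplicative.ofAdd <| by
    rw [Subgroup.coe_mul, crossing_mul, g.2, map_one]
    rfl

theorem crossing_pow_of_permBar_eq_one {a : BraidQuot n} (ha : permBar n a = 1) (k : ℕ) :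
    crossing (a ^ k) = k • crossing a :=
  map_pow (pureCrossing n) ⟨a, ha⟩ k

theorem crossing_list_prod_of_permBar_eq_one {l : List (BraidQuot n)}
    (hl : ∀ a ∈ l, permBar n a = 1) : crossing l.prod = (l.map crossing).sum := by
  induction l with
  | nil => exact crossing_one
  | cons a l ih =>
    rw [List.forall_mem_cons] at hl
    rw [List.prod_cons, crossing_mul, hl.1, map_one, ih hl.2]
    rfl

variable {ι : Type*} [Fintype ι] {v : ι → BraidQuot n} {hv : ∀ i j, Commute (v i) (v j)}

theorem crossing_powHom (hv1 : ∀ i, permBar n (v i) = 1) (f : ι → Multiplicative ℤ) :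
    crossing (powHom v hv f) = ∑ i, (f i).toAdd • crossing (v i) := by
  let w : ι → (permBar n).ker := fun i => ⟨v i, hv1 i⟩
  have hw : ∀ i j, Commute (w i) (w j) := fun i j => Subtype.ext (hv i j)
  have h_coe : (permBar n).ker.subtype (powHom w hw f) = powHom v hv f :=
    map_powHom _ hv (fun _ => rfl) f
  have h_map := map_powHom (pureCrossing n) (hv := hw) (fun _ _ => Commute.all _ _)
    (fun _ => rfl) f
  rw [powHom_apply] at h_map
  rw [← h_coe]
  exact (congrArg Multiplicative.toAdd h_map).trans (toAdd_prod _ _)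

theorem powHom_eq_one_of_crossing_eq_zero (hv1 : ∀ i, permBar n (v i) = 1)
    (hli : LinearIndependent ℤ fun i => crossing (v i)) {f : ι → Multiplicative ℤ}
    (hf : crossing (powHom v hv f) = 0) : f = 1 := by
  rw [crossing_powHom hv1] at hf
  exact funext (Fintype.linearIndependent_iff.1 hli _ hf)

/-- The characteristic function of the pair of the strings `a` and `b`, counted from `0`; it is
zero when `a` or `b` is out of range. -/
def natEdge (n a b : ℕ) : Sym2 (Fin n) → ℤ :=
  fun s => if s.map Fin.val = s(a, b) then 1 else 0

theorem natEdge_comm (n a b : ℕ) : natEdge n a b = natEdge n b a := by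
  unfold natEdge
  rw [Sym2.eq_swap]

theorem natEdge_val (x y : Fin n) : natEdge n x y = edge s(x, y) := by
  funext s
  have : s.map Fin.val = s((x : ℕ), (y : ℕ)) ↔ s = s(x, y) := by
    rw [← Sym2.map_mk, (Sym2.map.injective Fin.val_injective).eq_iff]
  simp only [natEdge, edge_apply, this]

theorem act_natEdge (g : Equiv.Perm (Fin n)) {a b : ℕ} (ha : a < n) (hb : b < n) :
    act g (natEdge n a b) = natEdge n (g ⟨a, ha⟩) (g ⟨b, hb⟩) := by
  rw [natEdge_val, ← act_edge, ← natEdge_val]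

theorem crossing_sig {i : ℕ} (hi : 1 ≤ i) (hin : i < n) :
    crossing (sig n i) = natEdge n (i - 1) i := by
  have h_model : modelHom n (sig n i) = modelGen n ⟨i - 1, by omega⟩ := by
    rw [sig_eq hi hin]
    exact PresentedGroup.toGroup.of (lift_modelGen_eq_one n)
  rw [crossing, h_model]
  refine (natEdge_val _ _).symm.trans ?_
  simp only [Nat.sub_add_cancel hi]

theorem act_permBar_sig {i : ℕ} (hi : 1 ≤ i) (hin : i < n) :
    act (permBar n (sig n i)) (natEdge n (i - 1) i) = natEdge n (i - 1) i := by
  rw [act_natEdge _ (by omega) hin, actsByAdjSwaps_permBar.val_apply hi hin,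
    actsByAdjSwaps_permBar.val_apply hi hin, if_pos rfl, if_neg (by simp only; omega), if_pos rfl,
    natEdge_comm]

theorem crossing_sig_inv {i : ℕ} (hi : 1 ≤ i) (hin : i < n) :
    crossing (sig n i)⁻¹ = -natEdge n (i - 1) i := by
  refine (act (permBar n (sig n i))).injective ?_
  rw [act_permBar_inv_crossing, crossing_sig hi hin, map_neg, act_permBar_sig hi hin]

theorem crossing_sig_sq {i : ℕ} (hi : 1 ≤ i) (hin : i < n) :
    crossing (sig n i ^ 2) = (2 : ℤ) • natEdge n (i - 1) i := by
  rw [pow_two, crossing_mul, crossing_sig hi hin, act_permBar_sig hi hin, two_smul]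

theorem crossing_descProd {F : ℕ → BraidQuot n} (hF : ActsByAdjSwaps (permBar n) F) {ε : ℕ → ℤ}
    (a m : ℕ) (hm : a + m < n)
    (hε : ∀ k < m, crossing (F (a + k + 1)) = ε k • natEdge n (a + k) (a + k + 1)) :
    crossing (descProd F (a + 1) (a + m)) =
      ∑ k ∈ Finset.range m, ε k • natEdge n (a + k) (a + m) := by
  induction m with
  | zero => rw [descProd_of_lt F (by omega), crossing_one, Finset.sum_range_zero]
  | succ m ih =>
    rw [← add_assoc, descProd_succ_top F (by omega), crossing_mul, hε m (by omega),
      ih (by omega) fun k hk => hε k (by omega), map_sum, Finset.sum_range_succ, add_comm]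
    congr 1
    refine Finset.sum_congr rfl fun k hk => ?_
    rw [Finset.mem_range] at hk
    have hm' : a + m + 1 < n := hm
    rw [map_zsmul, act_natEdge _ (by omega) (by omega), hF.val_apply (by omega) hm',
      hF.val_apply (by omega) hm']
    simp only
    rw [if_neg (by omega), if_neg (by omega), if_pos (by omega)]

theorem crossing_pureGen {i j : ℕ} (hi : 1 ≤ i) (hij : i < j) (hj : j ≤ n) :
    crossing (pureGen n i j) = (2 : ℤ) • natEdge n (i - 1) (j - 1) := by
  have hin : i < n := by omega
  have h_sq : permBar n (sig n i ^ 2) = 1 := by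
    rw [← pureGen_succ_self, permBar_pureGen hi hin]
  rw [pureGen, crossing_conj _ h_sq, crossing_sig_sq hi hin, map_zsmul,
    act_natEdge _ (by omega) hin,
    actsByAdjSwaps_permBar.val_descProd_apply (by omega) (by omega) (by omega),
    actsByAdjSwaps_permBar.val_descProd_apply (by omega) (by omega) (by omega)]
  simp only
  rw [if_neg (by omega), if_neg (by omega), if_pos (by omega)]

variable (n) in
/-- The pure braid generators, indexed by the pairs of positions counted from `0`. -/
def pureGenOfPair (p : {p : Fin n × Fin n // p.1 < p.2}) : BraidQuot n :=
  pureGen n (p.1.1 + 1) (p.1.2 + 1)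

theorem permBar_pureGenOfPair (p : {p : Fin n × Fin n // p.1 < p.2}) :
    permBar n (pureGenOfPair n p) = 1 :=
  permBar_pureGen (by omega) (by have := p.2; omega)

theorem linearIndependent_crossing_pureGenOfPair :
    LinearIndependent ℤ fun p => crossing (pureGenOfPair n p) := by
  have h_crossing : ∀ p, crossing (pureGenOfPair n p) = (2 : ℤ) • edge s(p.1.1, p.1.2) := by
    rintro ⟨⟨a, b⟩, hab⟩
    rw [← natEdge_val]
    have hab' : (a : ℕ) < b := hab
    exact crossing_pureGen (by omega) (by simpa using hab') (by simp only; omega)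
  refine linearIndependent_of_triangular (fun p => s(p.1.1, p.1.2)) (fun _ => 0) (fun p => ?_)
    fun p p' hp _ => ?_
  · simp [h_crossing, edge_apply]
  · suffices s(p'.1.1, p'.1.2) ≠ s(p.1.1, p.1.2) by simp [h_crossing, edge_apply, this]
    rw [Ne, Sym2.eq_iff]
    rintro (⟨h₁, h₂⟩ | ⟨h₁, h₂⟩)
    · exact hp (Subtype.ext (Prod.ext h₁.symm h₂.symm))
    · have := p'.2
      rw [h₁, h₂] at this
      exact this.asymm p.2

theorem range_pureGenOfPair : Set.range (pureGenOfPair n) = pureGens n := by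
  refine Set.Subset.antisymm ?_ ?_
  · rintro _ ⟨⟨⟨a, b⟩, hab⟩, rfl⟩
    exact ⟨a + 1, b + 1, by omega, by simp only at hab; omega, by omega, rfl⟩
  · rintro _ ⟨i, j, hi, hij, hj, rfl⟩
    obtain ⟨i, rfl⟩ : ∃ k, i = k + 1 := ⟨i - 1, by omega⟩
    obtain ⟨j, rfl⟩ : ∃ k, j = k + 1 := ⟨j - 1, by omega⟩
    exact ⟨⟨(⟨i, by omega⟩, ⟨j, by omega⟩), by simp only [Fin.mk_lt_mk]; omega⟩, rfl⟩

theorem eq_one_of_crossing_eq_zero {g : BraidQuot n} (hg : permBar n g = 1)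
    (hg' : crossing g = 0) : g = 1 := by
  have h_comm : ∀ p p', Commute (pureGenOfPair n p) (pureGenOfPair n p') := fun p p' =>
    commute_of_permBar_eq_one (permBar_pureGenOfPair p) (permBar_pureGenOfPair p')
  have h_mem : g ∈ (powHom (pureGenOfPair n) h_comm).range := by
    rw [range_powHom, range_pureGenOfPair, ← ker_permBar]
    exact hg
  obtain ⟨f, rfl⟩ := h_mem
  rw [powHom_eq_one_of_crossing_eq_zero permBar_pureGenOfPair
    linearIndependent_crossing_pureGenOfPair hg', map_one]

theorem eq_of_crossing_eq {g h : BraidQuot n} (hperm : permBar n g = permBar n h)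
    (hcross : crossing g = crossing h) : g = h := by
  rw [← mul_inv_eq_one]
  refine eq_one_of_crossing_eq_zero (by rw [map_mul, map_inv, hperm, mul_inv_cancel]) ?_
  rw [crossing_mul, hperm, act_permBar_inv_crossing, hcross, add_neg_cancel]

end Crossings

/-! ### Rotation of the blocks -/

section Residues

theorem sum_range_natCast_zmod {M : Type*} [AddCommMonoid M] (N : ℕ) [NeZero N] (f : ZMod N → M) :
    ∑ i ∈ Finset.range N, f i = ∑ x, f x :=
  Finset.sum_bij' (fun i _ => (i : ZMod N)) (fun x _ => x.val) (fun _ _ => Finset.mem_univ _)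
    (fun x _ => Finset.mem_range.2 x.val_lt)
    (fun _ hi => ZMod.val_natCast_of_lt (Finset.mem_range.1 hi))
    (fun x _ => ZMod.natCast_zmod_val x) fun _ _ => rfl

theorem natCast_finRotate {N M : ℕ} (hM : M ∣ N) (k : Fin N) :
    ((finRotate N k : ℕ) : ZMod M) = (k : ℕ) + 1 := by
  cases N with
  | zero => exact k.elim0
  | succ N =>
    rw [finRotate_apply, Fin.val_add, Fin.val_one', Nat.add_mod_mod, ← Nat.cast_succ,
      ZMod.natCast_eq_natCast_iff]
    exact (Nat.mod_modEq _ _).of_dvd hM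

theorem val_finRotate {N : ℕ} {k : Fin N} (hk : (k : ℕ) + 1 < N) :
    (finRotate N k : ℕ) = k + 1 := by
  cases N with
  | zero => exact k.elim0
  | succ N => exact coe_finRotate_of_ne_last (Fin.ne_of_lt (Nat.lt_of_succ_lt_succ hk))

theorem sym2_add_natCast_inj {N u v : ℕ} {x y : ZMod N} (hu : 0 < u) (huN : 2 * u < N)
    (hvN : 2 * v < N) (h : s(x, x + u) = s(y, y + v)) : x = y ∧ u = v := by
  rcases Sym2.eq_iff.1 h with ⟨rfl, h⟩ | ⟨rfl, h⟩
  · exact ⟨rfl, CharP.natCast_injOn_Iio (ZMod N) N (show u < N by omega) (show v < N by omega)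
      (add_left_cancel h)⟩
  · rw [add_assoc, add_eq_left, ← Nat.cast_add, ← Nat.cast_zero] at h
    have := CharP.natCast_injOn_Iio (ZMod N) N (show v + u < N by omega) (show 0 < N by omega) h
    omega

theorem exists_sym2_add_natCast {N : ℕ} (hN : Odd N) {x y : ZMod N} (hxy : x ≠ y) :
    ∃ (z : ZMod N) (u : ℕ), 0 < u ∧ 2 * u < N ∧ s(z, z + u) = s(x, y) := by
  have : NeZero N := ⟨hN.pos.ne'⟩
  have h_of_le : ∀ x y : ZMod N, x ≠ y → 2 * (y - x).val < N →
      ∃ (z : ZMod N) (u : ℕ), 0 < u ∧ 2 * u < N ∧ s(z, z + u) = s(x, y) := fun x y hxy h =>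
    ⟨x, _, ZMod.val_pos.2 (sub_ne_zero.2 hxy.symm), h, by
      rw [ZMod.natCast_zmod_val, add_sub_cancel]⟩
  rcases lt_or_ge (2 * (y - x).val) N with h | h
  · exact h_of_le x y hxy h
  · rw [Sym2.eq_swap]
    have : NeZero (y - x) := ⟨sub_ne_zero.2 hxy.symm⟩
    refine h_of_le y x hxy.symm ?_
    rw [← neg_sub, ZMod.val_neg_of_ne_zero]
    obtain ⟨k, hk⟩ := hN
    have := (y - x).val_lt
    omega

theorem bijective_natCast_zmod_prod {M N : ℕ} [NeZero M] [NeZero N] (h : M.Coprime N) :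
    Function.Bijective fun k : Fin (M * N) => (((k : ℕ) : ZMod M), ((k : ℕ) : ZMod N)) := by
  refine (Fintype.bijective_iff_injective_and_card _).2 ⟨fun k l hkl => Fin.ext ?_, ?_⟩
  · simp only [Prod.mk.injEq, ZMod.natCast_eq_natCast_iff] at hkl
    exact ((Nat.modEq_and_modEq_iff_modEq_mul h).1 hkl).eq_of_lt_of_lt k.2 l.2
  · simp only [Fintype.card_fin, Fintype.card_prod, ZMod.card]

end Residues

section Strands

variable {t : ℕ} {P : Fin t → ℕ}

theorem offset_add_le_offset {i j : Fin t} (h : i < j) : offset P i + P i ≤ offset P j := by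
  rw [offset, add_comm, ← Finset.sum_insert (by simp)]
  refine Finset.sum_le_sum_of_subset (Finset.insert_subset (Finset.mem_Iio.2 h) ?_)
  exact Finset.Iio_subset_Iio h.le

theorem offset_add_le_strands (j : Fin t) : offset P j + P j ≤ strands P := by
  rw [offset, add_comm, ← Finset.sum_insert (by simp)]
  exact Finset.sum_le_sum_of_subset (Finset.subset_univ _)

variable [∀ j, NeZero (P j)]

/-- The strings of block `j`, parametrized by the residues modulo `P j`. -/
def strand (j : Fin t) (x : ZMod (P j)) : Fin (strands P) :=
  ⟨offset P j + x.val, (Nat.add_lt_add_left x.val_lt _).trans_le (offset_add_le_strands j)⟩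

theorem val_strand (j : Fin t) (x : ZMod (P j)) : (strand j x : ℕ) = offset P j + x.val := rfl

theorem val_strand_natCast (j : Fin t) {u : ℕ} (hu : u < P j) :
    (strand j (u : ZMod (P j)) : ℕ) = offset P j + u := by
  rw [val_strand, ZMod.val_natCast_of_lt hu]

theorem block_eq_of_strand_eq {i j : Fin t} {x : ZMod (P i)} {y : ZMod (P j)}
    (h : strand i x = strand j y) : i = j := by
  have h_val : offset P i + x.val = offset P j + y.val := congrArg Fin.val h
  have := x.val_lt
  have := y.val_lt
  rcases lt_trichotomy i j with hij | hij | hij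
  · have := offset_add_le_offset (P := P) hij
    omega
  · exact hij
  · have := offset_add_le_offset (P := P) hij
    omega

theorem strand_injective (j : Fin t) : Function.Injective (strand (P := P) j) := fun _ _ h =>
  ZMod.val_injective _ (Nat.add_left_cancel (congrArg Fin.val h))

theorem strand_bijective :
    Function.Bijective fun s : Σ j, ZMod (P j) => strand s.1 s.2 := by
  refine (Fintype.bijective_iff_injective_and_card _).2 ⟨?_, ?_⟩
  · rintro ⟨i, x⟩ ⟨j, y⟩ h
    obtain rfl := block_eq_of_strand_eq h
    exact congrArg _ (strand_injective i h)
  · rw [Fintype.card_sigma, Fintype.card_fin, strands]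
    simp only [ZMod.card]

theorem exists_strand_eq (x : Fin (strands P)) : ∃ j y, strand (P := P) j y = x :=
  let ⟨⟨j, y⟩, h⟩ := strand_bijective.2 x
  ⟨j, y, h⟩

variable (P) in
/-- The strings, sorted by blocks. -/
noncomputable def strandEquiv : (Σ j, ZMod (P j)) ≃ Fin (strands P) :=
  Equiv.ofBijective _ strand_bijective

theorem strandEquiv_mk (j : Fin t) (x : ZMod (P j)) : strandEquiv P ⟨j, x⟩ = strand j x := rfl

variable (P) in
/-- The action of `∏ j, ZMod (P j)` on the strings, in which the component `c j` rotates block `j`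
by `-c j`. -/
noncomputable def rotation :
    Multiplicative (∀ j, ZMod (P j)) →* Equiv.Perm (Fin (strands P)) where
  toFun c := (strandEquiv P).permCongr
    (Equiv.sigmaCongrRight fun j => Equiv.subRight (c.toAdd j))
  map_one' := by
    ext x
    obtain ⟨s, rfl⟩ := (strandEquiv P).surjective x
    simp
  map_mul' c d := by
    ext x
    obtain ⟨s, rfl⟩ := (strandEquiv P).surjective x
    simp [Equiv.permCongr_apply, sub_sub, add_comm]

theorem rotation_strand (c : ∀ j, ZMod (P j)) (j : Fin t) (x : ZMod (P j)) :
    rotation P (.ofAdd c) (strand j x) = strand j (x - c j) := by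
  rw [← strandEquiv_mk, ← strandEquiv_mk]
  simp only [rotation, MonoidHom.coe_mk, OneHom.coe_mk, Equiv.permCongr_apply,
    Equiv.symm_apply_apply]
  rfl

theorem rotation_injective : Function.Injective (rotation P) := by
  intro c d h
  funext j
  have h_zero := DFunLike.congr_fun h (strand j 0)
  rw [← ofAdd_toAdd c, ← ofAdd_toAdd d, rotation_strand, rotation_strand] at h_zero
  exact sub_right_injective (strand_injective j h_zero)

theorem act_rotation_edge (c : ∀ j, ZMod (P j)) (i j : Fin t) (x : ZMod (P i)) (y : ZMod (P j)) :
    act (rotation P (.ofAdd c)) (edge s(strand i x, strand j y)) =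
      edge s(strand i (x - c i), strand j (y - c j)) := by
  rw [act_edge, rotation_strand, rotation_strand]

theorem crossing_pureGen_strand {a b : Fin t} {u v : ℕ} (hu : u < P a) (hv : v < P b)
    (huv : offset P a + u < offset P b + v) :
    crossing (pureGen (strands P) (offset P a + u + 1) (offset P b + v + 1)) =
      (2 : ℤ) • edge s(strand a u, strand b v) := by
  have := offset_add_le_strands (P := P) b
  rw [crossing_pureGen (by omega) (by omega) (by omega), ← natEdge_val, val_strand_natCast a hu,
    val_strand_natCast b hv]
  rfl

end Strands

section Delta

theorem descProd_congr {G : Type*} [Group G] {f g : ℕ → G} {a b : ℕ}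
    (h : ∀ i, a ≤ i → i ≤ b → f i = g i) : descProd f a b = descProd g a b := by
  refine congrArg List.prod (List.map_congr_left fun i hi => ?_)
  rw [List.mem_reverse, List.mem_range'_1] at hi
  exact h i hi.1 (by omega)

variable {n m z : ℕ}

/-- The `i`-th letter of the braid word `deltaBlock n m z`. -/
def deltaLetter (n m z i : ℕ) : BraidQuot n :=
  if m + z / 2 < i then sig n i else (sig n i)⁻¹

theorem deltaBlock_eq_descProd (hz : Odd z) :
    deltaBlock n m z = descProd (deltaLetter n m z) (m + 1) (m + (z - 1)) := by
  obtain ⟨k, rfl⟩ := hz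
  rw [deltaBlock, ← descProd_mul (deltaLetter n m (2 * k + 1)) (by omega : m + 1 ≤ m + k + 1)
    (by omega)]
  congr 1
  · rw [show m + (2 * k + 1 + 1) / 2 = m + k + 1 by omega]
    exact descProd_congr fun i hi _ => (if_pos (by omega)).symm
  · rw [show m + (2 * k + 1 - 1) / 2 = m + k by omega]
    exact descProd_congr fun i _ hi => (if_neg (by omega)).symm

theorem actsByAdjSwaps_deltaLetter : ActsByAdjSwaps (permBar n) (deltaLetter n m z) := by
  intro i hi hin
  rw [deltaLetter]
  split_ifs
  · exact actsByAdjSwaps_permBar i hi hin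
  · rw [map_inv, actsByAdjSwaps_permBar i hi hin]
    exact Equiv.swap_inv _ _

theorem crossing_deltaLetter {i : ℕ} (hi : 1 ≤ i) (hin : i < n) :
    crossing (deltaLetter n m z i) =
      (if m + z / 2 < i then 1 else -1 : ℤ) • natEdge n (i - 1) i := by
  rw [deltaLetter]
  split_ifs
  · rw [crossing_sig hi hin, one_smul]
  · rw [crossing_sig_inv hi hin, neg_one_smul]

variable {t : ℕ} {P : Fin t → ℕ}

theorem permBar_deltaConj {s : ℕ} {g : BraidQuot (strands P)}
    (hg : permBar (strands P) g = 1) : permBar (strands P) (deltaConj P s g) = 1 :=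
  permBar_conj _ (by rw [map_pow, hg, one_pow])

/-- The hypotheses on the block sizes under which the structure of `Gamma P` is determined. -/
class Admissible (P : Fin t → ℕ) : Prop where
  odd : ∀ j, Odd (P j)
  one_lt : ∀ j, 1 < P j
  coprime : Pairwise fun i j => (P i).Coprime (P j)

instance [Admissible P] (j : Fin t) : NeZero (P j) :=
  ⟨(zero_lt_one.trans (Admissible.one_lt j)).ne'⟩

variable [Admissible P]

theorem Admissible.three_le (j : Fin t) : 3 ≤ P j := by
  have := Admissible.one_lt (P := P) j
  obtain ⟨k, hk⟩ := Admissible.odd (P := P) j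
  omega

theorem permBar_delta (j : Fin t) :
    permBar (strands P) (delta P j) = rotation P (.ofAdd (Pi.single j 1)) := by
  have h3 := Admissible.three_le (P := P) j
  have hle := offset_add_le_strands (P := P) j
  ext x
  obtain ⟨i, y, rfl⟩ := exists_strand_eq x
  rw [delta, deltaBlock_eq_descProd (Admissible.odd j),
    actsByAdjSwaps_deltaLetter.val_descProd_apply (by omega) (by omega) (by omega), rotation_strand]
  have hy := y.val_lt
  rcases lt_trichotomy i j with hij | rfl | hij
  · have := offset_add_le_offset (P := P) hij
    rw [Pi.single_eq_of_ne hij.ne, sub_zero, val_strand, if_neg (by omega), if_neg (by omega)]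
  · obtain ⟨u, hu, rfl⟩ : ∃ u < P i, (u : ZMod (P i)) = y := ⟨_, hy, ZMod.natCast_zmod_val y⟩
    rw [Pi.single_eq_same, val_strand_natCast i hu]
    cases u with
    | zero =>
      have h_pred : ((0 : ℕ) : ZMod (P i)) - 1 = (P i - 1 : ℕ) := by
        rw [Nat.cast_sub (by omega), ZMod.natCast_self, Nat.cast_zero, Nat.cast_one]
      rw [h_pred, val_strand_natCast i (by omega), if_pos (by omega)]
    | succ u =>
      rw [Nat.cast_succ, add_sub_cancel_right, val_strand_natCast i (by omega),
        if_neg (by omega), if_pos (by omega)]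
      omega
  · have := offset_add_le_offset (P := P) hij
    rw [Pi.single_eq_of_ne hij.ne', sub_zero, val_strand, if_neg (by omega), if_neg (by omega)]

theorem permBar_rotElt (j : Fin t) :
    permBar (strands P) (rotElt P j) = rotation P (.ofAdd (Pi.single j 1)) := by
  have := offset_add_le_strands (P := P) j
  have := Admissible.three_le (P := P) j
  rw [rotElt, map_mul, permBar_pureGen (by omega) (by omega), one_mul, permBar_delta]

theorem permBar_deltaTotal :
    permBar (strands P) (deltaTotal P) = rotation P (.ofAdd 1) := by
  have h_prod : (List.ofFn fun j => Multiplicative.ofAdd (Pi.single j 1 : ∀ j, ZMod (P j))).prod =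
      .ofAdd 1 := by
    rw [List.prod_ofFn]
    exact Finset.univ_sum_single (1 : ∀ j, ZMod (P j))
  rw [deltaTotal, map_list_prod, List.map_ofFn, ← h_prod, map_list_prod, List.map_ofFn]
  exact congrArg (fun f => (List.ofFn f).prod) (funext permBar_delta)

/-- The sum of the pairs of strings of block `j` at distance `d`. -/
noncomputable def orbitSum (j : Fin t) (d : ZMod (P j)) : Sym2 (Fin (strands P)) → ℤ :=
  ∑ x, edge s(strand j x, strand j (x + d))

theorem orbitSum_neg (j : Fin t) (d : ZMod (P j)) : orbitSum j (-d) = orbitSum j d := by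
  refine (Fintype.sum_equiv (Equiv.addRight d) _ _ fun x => ?_).symm
  rw [Equiv.coe_addRight, add_neg_cancel_right, Sym2.eq_swap]

theorem rotation_single_pow (j : Fin t) (k : ℕ) :
    rotation P (.ofAdd (Pi.single j 1)) ^ k = rotation P (.ofAdd (Pi.single j k)) := by
  rw [← map_pow, ← ofAdd_nsmul, ← Pi.single_smul, nsmul_one]

theorem sum_act_rotation (j : Fin t) (x y : ZMod (P j)) :
    ∑ i ∈ Finset.range (P j),
      act (rotation P (.ofAdd (Pi.single j 1)) ^ i) (edge s(strand j x, strand j y)) =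
        orbitSum j (y - x) := by
  simp only [rotation_single_pow, act_rotation_edge, Pi.single_eq_same]
  rw [sum_range_natCast_zmod (P j) fun k => edge s(strand j (x - k), strand j (y - k))]
  refine Fintype.sum_equiv (Equiv.subLeft x) _ _ fun k => ?_
  rw [Equiv.subLeft_apply, show x - k + (y - x) = y - k by ring]

theorem crossing_delta (j : Fin t) :
    crossing (delta P j) = ∑ u ∈ Finset.range (P j - 1),
      (if P j / 2 ≤ u then 1 else -1 : ℤ) •
        edge s(strand j (u : ZMod (P j)), strand j ((P j - 1 : ℕ) : ZMod (P j))) := by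
  have h3 := Admissible.three_le (P := P) j
  have hle := offset_add_le_strands (P := P) j
  rw [delta, deltaBlock_eq_descProd (Admissible.odd j),
    crossing_descProd actsByAdjSwaps_deltaLetter (ε := fun u => if P j / 2 ≤ u then 1 else -1)
      _ _ (by omega) fun u hu => ?_]
  · refine Finset.sum_congr rfl fun u hu => ?_
    rw [Finset.mem_range] at hu
    rw [← natEdge_val, val_strand_natCast j (by omega), val_strand_natCast j (by omega)]
  · rw [crossing_deltaLetter (by omega) (by omega)]
    have : offset P j + P j / 2 < offset P j + u + 1 ↔ P j / 2 ≤ u := by omega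
    simp only [this]
    rfl

/-- The orbits of the distances `d` and `-d` agree, and the corresponding letters of `δ` have
opposite signs. -/
theorem sum_act_crossing_delta (j : Fin t) :
    ∑ i ∈ Finset.range (P j),
      act (rotation P (.ofAdd (Pi.single j 1)) ^ i) (crossing (delta P j)) = 0 := by
  have h3 := Admissible.three_le (P := P) j
  let term (u : ℕ) : Sym2 (Fin (strands P)) → ℤ :=
    (if P j / 2 ≤ u then 1 else -1 : ℤ) • orbitSum j ((u + 1 : ℕ) : ZMod (P j))
  have h_orbits : ∑ i ∈ Finset.range (P j),
      act (rotation P (.ofAdd (Pi.single j 1)) ^ i) (crossing (delta P j)) =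
        ∑ u ∈ Finset.range (P j - 1), term u := by
    simp only [crossing_delta, map_sum, map_zsmul]
    rw [Finset.sum_comm]
    refine Finset.sum_congr rfl fun u _ => ?_
    rw [← Finset.smul_sum, sum_act_rotation, ← orbitSum_neg, Nat.cast_sub (by omega),
      ZMod.natCast_self, neg_sub, Nat.cast_one, zero_sub, sub_neg_eq_add, ← Nat.cast_succ]
  have h_reflect : ∀ u ∈ Finset.range (P j - 1), term (P j - 1 - 1 - u) = -term u := by
    intro u hu
    rw [Finset.mem_range] at hu
    have h_dist : ((P j - 1 - 1 - u + 1 : ℕ) : ZMod (P j)) = -((u + 1 : ℕ) : ZMod (P j)) := by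
      rw [eq_neg_iff_add_eq_zero, ← Nat.cast_add,
        show P j - 1 - 1 - u + 1 + (u + 1) = P j by omega, ZMod.natCast_self]
    obtain ⟨k, hk⟩ := Admissible.odd (P := P) j
    simp only [term]
    rw [h_dist, orbitSum_neg, ← neg_smul]
    congr 1
    split_ifs <;> first | rfl | omega
  rw [h_orbits]
  refine self_eq_neg.1 ?_
  rw [← Finset.sum_neg_distrib, ← Finset.sum_range_reflect]
  exact Finset.sum_congr rfl h_reflect

theorem crossing_rotElt (j : Fin t) :
    crossing (rotElt P j) = (2 : ℤ) • edge s(strand j 0, strand j 1) + crossing (delta P j) := by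
  have := offset_add_le_strands (P := P) j
  have := Admissible.three_le (P := P) j
  have h_pure := crossing_pureGen_strand (P := P) (a := j) (b := j) (u := 0) (v := 1) (by omega)
    (by omega) (by omega)
  rw [Nat.cast_zero, Nat.cast_one] at h_pure
  rw [rotElt, crossing_mul, permBar_pureGen (by omega) (by omega), map_one, ← h_pure]
  rfl

theorem permBar_rotElt_pow (j : Fin t) : permBar (strands P) (rotElt P j ^ P j) = 1 := by
  rw [map_pow, permBar_rotElt, rotation_single_pow, ZMod.natCast_self, Pi.single_zero, ofAdd_zero,
    map_one]

theorem crossing_rotElt_pow (j : Fin t) :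
    crossing (rotElt P j ^ P j) = (2 : ℤ) • orbitSum j 1 := by
  rw [crossing_pow, permBar_rotElt, crossing_rotElt]
  simp only [map_add, map_zsmul]
  rw [Finset.sum_add_distrib, sum_act_crossing_delta, add_zero, ← Finset.smul_sum,
    sum_act_rotation, sub_zero]

theorem crossing_deltaConj (s : ℕ) {g : BraidQuot (strands P)}
    (hg : permBar (strands P) g = 1) {i j : Fin t} {x : ZMod (P i)} {y : ZMod (P j)}
    (hc : crossing g = (2 : ℤ) • edge s(strand i x, strand j y)) :
    crossing (deltaConj P s g) =
      (2 * order P : ℤ) •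
        edge s(strand i (x - (s : ZMod (P i))), strand j (y - (s : ZMod (P j)))) := by
  have h_perm : permBar (strands P) (deltaTotal P ^ s) = rotation P (.ofAdd fun _ => s) := by
    rw [map_pow, permBar_deltaTotal, ← map_pow, ← ofAdd_nsmul, nsmul_one]
    rfl
  rw [deltaConj, crossing_conj _ (by rw [map_pow, hg, one_pow]),
    crossing_pow_of_permBar_eq_one hg, hc, h_perm, map_nsmul, map_zsmul, act_rotation_edge,
    ← natCast_zsmul, smul_smul, mul_comm]

end Delta

/-! ### The lattice generators -/

section PairOf

variable {t : ℕ} {P : Fin t → ℕ}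

/-- The first string of the pair that belongs to the index `k = 0` of the orbit `h` of a block with
`N` strings. The orbit `h = 0` starts at `2`, since its index `k = 1` belongs to `A_{m+2,m+3}`. -/
def orbitStart (N h : ℕ) : ZMod N := if h = 0 then 2 else 0

/-- The indices of the lattice generators `x_j ^ P_j`. -/
def LatticeIndex.IsPower : LatticeIndex P → Prop
  | .inner _ h k => (h : ℕ) = 0 ∧ (k : ℕ) = 0
  | .cross _ _ _ _ => False

theorem latticeElt_power {j : Fin t} {h : Fin ((P j - 1) / 2)} {k : Fin (P j)}
    (hh : (h : ℕ) = 0) (hk : (k : ℕ) = 0) :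
    latticeElt P (.inner j h k) = rotElt P j ^ P j := by
  rw [latticeElt, if_pos hh, if_pos hk]

variable [∀ j, NeZero (P j)]

/-- The pair of strings that belongs to a lattice generator. -/
def pairOf : LatticeIndex P → Sym2 (Fin (strands P))
  | .inner j h k =>
      s(strand j (orbitStart (P j) h - (k : ℕ)),
        strand j (orbitStart (P j) h - (k : ℕ) + (h + 1 : ℕ)))
  | .cross a b _ k => s(strand a (-(k : ℕ)), strand b (-(k : ℕ)))

theorem pairOf_inner_inj {j : Fin t} {h h' : Fin ((P j - 1) / 2)} {k k' : Fin (P j)}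
    (heq : pairOf (.inner j h k) = pairOf (.inner j h' k')) : h = h' ∧ k = k' := by
  obtain ⟨h_start, h_dist⟩ := sym2_add_natCast_inj (by omega) (by omega) (by omega)
    (Sym2.map.injective (strand_injective j) heq)
  obtain rfl : h = h' := Fin.ext (Nat.succ_injective h_dist)
  exact ⟨rfl, Fin.ext (CharP.natCast_injOn_Iio _ _ k.2 k'.2 (sub_right_injective h_start))⟩

theorem pairOf_inner_ne_cross {j a b : Fin t} {hab : a < b} {h : Fin ((P j - 1) / 2)}
    {k : Fin (P j)} {k' : Fin (P a * P b)} :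
    pairOf (.inner j h k) ≠ pairOf (.cross a b hab k') := fun heq => by
  rcases Sym2.eq_iff.1 heq with ⟨h₁, h₂⟩ | ⟨h₁, h₂⟩
  · exact hab.ne ((block_eq_of_strand_eq h₁).symm.trans (block_eq_of_strand_eq h₂))
  · exact hab.ne ((block_eq_of_strand_eq h₂).symm.trans (block_eq_of_strand_eq h₁))

theorem order_pos : 0 < order P := Finset.prod_pos fun j _ => NeZero.pos (P j)

theorem edge_pairOf_self (i : LatticeIndex P) : edge (pairOf i) (pairOf i) = 1 := by
  rw [edge_apply, if_pos rfl]

end PairOf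

section Lattice

variable {t : ℕ} {P : Fin t → ℕ} [Admissible P]

theorem pairOf_injective : Function.Injective (pairOf (P := P)) := by
  rintro (⟨j, h, k⟩ | ⟨a, b, hab, k⟩) (⟨j', h', k'⟩ | ⟨a', b', hab', k'⟩) heq
  · obtain rfl : j = j' := by
      rcases Sym2.eq_iff.1 heq with ⟨h, -⟩ | ⟨h, -⟩ <;> exact block_eq_of_strand_eq h
    obtain ⟨rfl, rfl⟩ := pairOf_inner_inj heq
    rfl
  · exact (pairOf_inner_ne_cross heq).elim
  · exact (pairOf_inner_ne_cross heq.symm).elim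
  · rcases Sym2.eq_iff.1 heq with ⟨ha, hb⟩ | ⟨ha, hb⟩ <;>
      obtain rfl := block_eq_of_strand_eq ha <;> obtain rfl := block_eq_of_strand_eq hb
    · obtain rfl := (bijective_natCast_zmod_prod (Admissible.coprime hab.ne)).1 <|
        Prod.ext (neg_injective (strand_injective a ha)) (neg_injective (strand_injective b hb))
      rfl
    · exact absurd hab hab'.asymm

theorem pairOf_not_isDiag (i : LatticeIndex P) : ¬ (pairOf i).IsDiag := by
  rcases i with ⟨j, h, k⟩ | ⟨a, b, hab, k⟩
  · intro h_diag
    have h_eq := strand_injective j (Sym2.mk_isDiag_iff.1 h_diag)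
    rw [left_eq_add, ← Nat.cast_zero] at h_eq
    have := CharP.natCast_injOn_Iio (ZMod (P j)) (P j) (show (h : ℕ) + 1 < P j by omega)
      (NeZero.pos (P j)) h_eq
    omega
  · exact fun h_diag => hab.ne (block_eq_of_strand_eq (Sym2.mk_isDiag_iff.1 h_diag))

theorem exists_pairOf_inner (j : Fin t) {x y : ZMod (P j)} (hxy : x ≠ y) :
    ∃ i, pairOf i = s(strand j x, strand j y) := by
  obtain ⟨z, u, hu, huN, hz⟩ := exists_sym2_add_natCast (Admissible.odd j) hxy
  let k := orbitStart (P j) (u - 1) - z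
  refine ⟨.inner j ⟨u - 1, by omega⟩ ⟨k.val, k.val_lt⟩, ?_⟩
  rw [← Sym2.map_mk, ← hz, Sym2.map_mk]
  simp only [pairOf, ZMod.natCast_zmod_val, k, sub_sub_cancel, Nat.sub_add_cancel hu]

theorem exists_pairOf_cross {a b : Fin t} (hab : a < b) (x : ZMod (P a)) (y : ZMod (P b)) :
    ∃ i, pairOf i = s(strand a x, strand b y) := by
  obtain ⟨k, hk⟩ := (bijective_natCast_zmod_prod (Admissible.coprime hab.ne)).2 (-x, -y)
  obtain ⟨hx, hy⟩ := Prod.mk.inj hk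
  refine ⟨.cross a b hab k, ?_⟩
  rw [pairOf, hx, hy, neg_neg, neg_neg]

theorem exists_pairOf {s : Sym2 (Fin (strands P))} (hs : ¬ s.IsDiag) : ∃ i, pairOf i = s := by
  induction s with
  | _ u v =>
    obtain ⟨i, x, rfl⟩ := exists_strand_eq u
    obtain ⟨j, y, rfl⟩ := exists_strand_eq v
    rcases lt_trichotomy i j with hij | rfl | hij
    · exact exists_pairOf_cross hij x y
    · exact exists_pairOf_inner i fun hxy => hs (Sym2.mk_isDiag_iff.2 (congrArg _ hxy))
    · rw [Sym2.eq_swap]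
      exact exists_pairOf_cross hij y x

noncomputable instance : Fintype (LatticeIndex P) := Fintype.ofInjective pairOf pairOf_injective

variable (P) in
theorem card_latticeIndex : Fintype.card (LatticeIndex P) = latticeRank P := by
  rw [latticeRank, ← Nat.choose_two_right]
  conv_rhs => rw [← Fintype.card_fin (strands P), ← Sym2.card_subtype_not_diag]
  refine Fintype.card_congr (Equiv.ofBijective (fun i => ⟨pairOf i, pairOf_not_isDiag i⟩) ⟨?_, ?_⟩)
  · exact fun i i' h => pairOf_injective (congrArg Subtype.val h)
  · rintro ⟨s, hs⟩
    obtain ⟨i, rfl⟩ := exists_pairOf hs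
    exact ⟨i, rfl⟩

theorem permBar_latticeElt (i : LatticeIndex P) : permBar (strands P) (latticeElt P i) = 1 := by
  rcases i with ⟨j, h, k⟩ | ⟨a, b, _, k⟩
  · have := offset_add_le_strands (P := P) j
    have := Admissible.three_le (P := P) j
    rw [latticeElt]
    split_ifs
    · exact permBar_rotElt_pow j
    · exact permBar_deltaConj (permBar_pureGen (by omega) (by omega))
    · exact permBar_deltaConj (permBar_pureGen (by omega) (by omega))
  · have := offset_add_le_strands (P := P) a
    have := Admissible.three_le (P := P) a
    exact permBar_deltaConj (permBar_pureGen (by omega) (by omega))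

theorem commute_latticeElt (i i' : LatticeIndex P) : Commute (latticeElt P i) (latticeElt P i') :=
  commute_of_permBar_eq_one (permBar_latticeElt i) (permBar_latticeElt i')

theorem crossing_latticeElt_inner {j : Fin t} {h : Fin ((P j - 1) / 2)} {k : Fin (P j)}
    (hi : ¬ (LatticeIndex.inner j h k).IsPower) :
    crossing (latticeElt P (.inner j h k)) =
      (2 * order P : ℤ) • edge (pairOf (.inner j h k)) := by
  have := offset_add_le_strands (P := P) j
  have := Admissible.three_le (P := P) j
  have := h.2
  rw [latticeElt, pairOf, orbitStart]
  by_cases hh : (h : ℕ) = 0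
  · have hk : (k : ℕ) ≠ 0 := fun hk => hi ⟨hh, hk⟩
    rw [if_pos hh, if_neg hk, if_pos hh, crossing_deltaConj _
      (permBar_pureGen (by omega) (by omega))
      (crossing_pureGen_strand (u := 1) (v := 2) (by omega) (by omega) (by omega)), hh,
      Nat.cast_pred (by omega)]
    push_cast
    ring_nf
  · rw [if_neg hh, if_neg hh, show offset P j + (h : ℕ) + 2 = offset P j + (h + 1) + 1 from rfl,
      crossing_deltaConj _ (permBar_pureGen (by omega) (by omega))
      (crossing_pureGen_strand (a := j) (b := j) (u := 0) (v := h + 1) (by omega) (by omega)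
        (by omega))]
    push_cast
    ring_nf

theorem crossing_latticeElt_cross {a b : Fin t} (hab : a < b) (k : Fin (P a * P b)) :
    crossing (latticeElt P (.cross a b hab k)) =
      (2 * order P : ℤ) • edge (pairOf (.cross a b hab k)) := by
  have := offset_add_le_offset (P := P) hab
  have := offset_add_le_strands (P := P) a
  have := Admissible.three_le (P := P) a
  have := Admissible.three_le (P := P) b
  rw [latticeElt, pairOf, crossing_deltaConj _ (permBar_pureGen (by omega) (by omega))
    (crossing_pureGen_strand (u := 0) (v := 0) (by omega) (by omega) (by omega)), Nat.cast_zero,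
    Nat.cast_zero, zero_sub, zero_sub]

theorem crossing_latticeElt {i : LatticeIndex P} (hi : ¬ i.IsPower) :
    crossing (latticeElt P i) = (2 * order P : ℤ) • edge (pairOf i) := by
  rcases i with _ | ⟨a, b, hab, k⟩
  · exact crossing_latticeElt_inner hi
  · exact crossing_latticeElt_cross hab k

theorem orbitSum_one_eq {j : Fin t} {h : Fin ((P j - 1) / 2)} (hh : (h : ℕ) = 0) :
    orbitSum j 1 = ∑ k, edge (pairOf (.inner j h k)) := by
  let pair (x : ZMod (P j)) := s(strand j x, strand j (x + (h + 1 : ℕ)))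
  calc orbitSum j 1 = ∑ x, edge (pair x) := by
        simp only [orbitSum, pair, hh, zero_add, Nat.cast_one]
    _ = ∑ x, edge (pair (orbitStart (P j) h - x)) :=
        (Fintype.sum_equiv (Equiv.subLeft _) _ _ fun _ => rfl).symm
    _ = ∑ k ∈ Finset.range (P j), edge (pair (orbitStart (P j) h - k)) :=
        (sum_range_natCast_zmod (P j) _).symm
    _ = ∑ k, edge (pairOf (.inner j h k)) := Finset.sum_range _

theorem crossing_latticeElt_power {j : Fin t} {h : Fin ((P j - 1) / 2)} {k : Fin (P j)}
    (hh : (h : ℕ) = 0) (hk : (k : ℕ) = 0) :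
    crossing (latticeElt P (.inner j h k)) =
      ∑ l, (2 : ℤ) • edge (pairOf (.inner j h l)) := by
  rw [latticeElt_power hh hk, crossing_rotElt_pow, orbitSum_one_eq hh, Finset.smul_sum]

theorem edge_pairOf_of_ne {i i' : LatticeIndex P} (h : i ≠ i') :
    edge (pairOf i) (pairOf i') = 0 := by
  rw [edge_apply, if_neg (pairOf_injective.ne h.symm)]

theorem crossing_latticeElt_apply_self (i : LatticeIndex P) :
    crossing (latticeElt P i) (pairOf i) ≠ 0 := by
  by_cases hi : i.IsPower
  · rcases i with ⟨j, h, k⟩ | _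
    · rw [crossing_latticeElt_power hi.1 hi.2, Finset.sum_apply,
        Finset.sum_eq_single_of_mem k (Finset.mem_univ k) fun l _ hl => ?_]
      · rw [Pi.smul_apply, edge_pairOf_self]
        exact two_ne_zero
      · rw [Pi.smul_apply, edge_pairOf_of_ne, smul_zero]
        rintro ⟨⟩
        exact hl rfl
    · exact hi.elim
  · have := order_pos (P := P)
    rw [crossing_latticeElt hi, Pi.smul_apply, edge_pairOf_self, smul_eq_mul, mul_one]
    omega

theorem crossing_latticeElt_apply_of_ne {i i' : LatticeIndex P} (hne : i ≠ i')
    (hpow : i.IsPower → i'.IsPower) : crossing (latticeElt P i) (pairOf i') = 0 := by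
  by_cases hi : i.IsPower
  · rcases i with ⟨j, h, k⟩ | _
    · rw [crossing_latticeElt_power hi.1 hi.2, Finset.sum_apply]
      refine Finset.sum_eq_zero fun l _ => ?_
      rw [Pi.smul_apply, edge_pairOf_of_ne, smul_zero]
      rintro rfl
      obtain rfl : k = l := Fin.ext (hi.2.trans (hpow hi).2.symm)
      exact hne rfl
    · exact hi.elim
  · rw [crossing_latticeElt hi, Pi.smul_apply, edge_pairOf_of_ne hne, smul_zero]

variable (P) in
theorem linearIndependent_crossing_latticeElt :
    LinearIndependent ℤ fun i => crossing (latticeElt P i) := by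
  classical
  refine linearIndependent_of_triangular pairOf (fun i => if i.IsPower then 0 else 1)
    crossing_latticeElt_apply_self fun i i' hne hrank => ?_
  refine crossing_latticeElt_apply_of_ne hne fun hi => ?_
  by_contra hi'
  rw [if_pos hi, if_neg hi'] at hrank
  omega

end Lattice

section Relations

variable {t : ℕ} {P : Fin t → ℕ}

variable (P) in
/-- The images of the generating symbols in `B_n / [P_n, P_n]`. -/
def genImage : PresGen P → BraidQuot (strands P) := Sum.elim (latticeElt P) (rotElt P)

theorem lift_genImage_symE (i : LatticeIndex P) :
    FreeGroup.lift (genImage P) (symE P i) = latticeElt P i := FreeGroup.lift_apply_of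

theorem lift_genImage_symX (j : Fin t) :
    FreeGroup.lift (genImage P) (symX P j) = rotElt P j := FreeGroup.lift_apply_of

variable [Admissible P]

theorem commute_rotElt (i j : Fin t) : Commute (rotElt P i) (rotElt P j) := by
  have h_act : ∀ {i j : Fin t}, j ≠ i →
      act (rotation P (.ofAdd (Pi.single i 1))) (crossing (rotElt P j)) =
        crossing (rotElt P j) := fun hij => by
    simp only [crossing_rotElt, crossing_delta, map_add, map_sum, map_zsmul, act_rotation_edge,
      Pi.single_eq_of_ne hij, sub_zero]
  rcases eq_or_ne i j with rfl | hij
  · exact Commute.refl _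
  · refine eq_of_crossing_eq ?_ ?_
    · rw [map_mul, map_mul, permBar_rotElt, permBar_rotElt, ← map_mul, mul_comm, map_mul]
    · rw [crossing_mul, crossing_mul, permBar_rotElt, permBar_rotElt, h_act hij.symm, h_act hij,
        add_comm]

theorem conj_latticeElt {g : BraidQuot (strands P)} {i i' : LatticeIndex P} (hi : ¬ i.IsPower)
    (hi' : ¬ i'.IsPower)
    (h : act (permBar (strands P) g) (edge (pairOf i)) = edge (pairOf i')) :
    g * latticeElt P i * g⁻¹ = latticeElt P i' := by
  refine eq_of_crossing_eq ?_ ?_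
  · rw [permBar_conj _ (permBar_latticeElt i), permBar_latticeElt]
  · rw [crossing_conj _ (permBar_latticeElt i), crossing_latticeElt hi, crossing_latticeElt hi',
      map_zsmul, h]

theorem act_rotElt_inner (j : Fin t) (h : Fin ((P j - 1) / 2)) (k : Fin (P j)) :
    act (permBar (strands P) (rotElt P j)) (edge (pairOf (.inner j h k))) =
      edge (pairOf (.inner j h (finRotate (P j) k))) := by
  rw [permBar_rotElt, pairOf, pairOf, act_rotation_edge, Pi.single_eq_same,
    natCast_finRotate dvd_rfl, sub_sub, add_sub_right_comm, sub_sub]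

theorem act_rotElt_inner_of_ne {i j : Fin t} (hij : i ≠ j) (h : Fin ((P j - 1) / 2))
    (k : Fin (P j)) :
    act (permBar (strands P) (rotElt P i)) (edge (pairOf (.inner j h k))) =
      edge (pairOf (.inner j h k)) := by
  rw [permBar_rotElt, pairOf, act_rotation_edge, Pi.single_eq_of_ne hij.symm, sub_zero, sub_zero]

theorem act_rotElt_cross_of_ne {i a b : Fin t} (hab : a < b) (hia : i ≠ a) (hib : i ≠ b)
    (k : Fin (P a * P b)) :
    act (permBar (strands P) (rotElt P i)) (edge (pairOf (.cross a b hab k))) =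
      edge (pairOf (.cross a b hab k)) := by
  rw [permBar_rotElt, pairOf, act_rotation_edge, Pi.single_eq_of_ne hia.symm,
    Pi.single_eq_of_ne hib.symm, sub_zero, sub_zero]

theorem act_rotElt_mul_cross {a b : Fin t} (hab : a < b) (k : Fin (P a * P b)) :
    act (permBar (strands P) (rotElt P a * rotElt P b)) (edge (pairOf (.cross a b hab k))) =
      edge (pairOf (.cross a b hab (finRotate (P a * P b) k))) := by
  rw [map_mul, permBar_rotElt, permBar_rotElt, ← map_mul, ← ofAdd_add, pairOf, pairOf,
    act_rotation_edge, Pi.add_apply, Pi.add_apply, Pi.single_eq_same, Pi.single_eq_same,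
    Pi.single_eq_of_ne hab.ne, Pi.single_eq_of_ne hab.ne', add_zero, zero_add,
    natCast_finRotate (dvd_mul_right _ _), natCast_finRotate (dvd_mul_left _ _), neg_add', neg_add']

theorem sum_map_filter_finRange {M : Type*} [AddCommMonoid M] {N : ℕ} (p : Fin N → Bool)
    (f : Fin N → M) :
    (((List.finRange N).filter p).map f).sum = ∑ l, if p l then f l else 0 := by
  rw [Fin.sum_univ_def]
  induction List.finRange N with
  | nil => rfl
  | cons x l ih => by_cases hx : p x <;> simp [hx, ih]

theorem finRotate_eq_of_val_add_one_eq {N : ℕ} {k k₀ : Fin N} (hk : (k : ℕ) + 1 = N)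
    (hk₀ : (k₀ : ℕ) = 0) : finRotate N k = k₀ := by
  cases N with
  | zero => exact k.elim0
  | succ N =>
    rw [show k = Fin.last N from Fin.ext (Nat.succ_injective hk), finRotate_last]
    exact Fin.ext hk₀.symm

/-- The product `e_{j,0,2}⁻¹ ⋯ e_{j,0,P_j}⁻¹`, for `h = 0`. -/
def tailProd (j : Fin t) (h : Fin ((P j - 1) / 2)) : BraidQuot (strands P) :=
  (((List.finRange (P j)).filter (fun l : Fin (P j) => decide (0 < (l : ℕ)))).map
    (fun l : Fin (P j) => (latticeElt P (.inner j h l))⁻¹)).prod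

theorem permBar_inv_latticeElt (i : LatticeIndex P) :
    permBar (strands P) (latticeElt P i)⁻¹ = 1 := by
  rw [map_inv, permBar_latticeElt, inv_one]

theorem permBar_tailProd (j : Fin t) (h : Fin ((P j - 1) / 2)) :
    permBar (strands P) (tailProd j h) = 1 := by
  refine (permBar (strands P)).ker.list_prod_mem fun a ha => ?_
  obtain ⟨l, -, rfl⟩ := List.mem_map.1 ha
  exact permBar_inv_latticeElt _

theorem crossing_tailProd (j : Fin t) (h : Fin ((P j - 1) / 2)) :
    crossing (tailProd j h) =
      ∑ l : Fin (P j), if 0 < (l : ℕ) then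
        -(2 * order P : ℤ) • edge (pairOf (.inner j h l)) else 0 := by
  rw [tailProd, crossing_list_prod_of_permBar_eq_one, List.map_map, sum_map_filter_finRange]
  · refine Finset.sum_congr rfl fun l _ => ?_
    simp only [decide_eq_true_eq, Function.comp_apply]
    refine if_ctx_congr Iff.rfl (fun hl => ?_) fun _ => rfl
    rw [← (act 1).injective.eq_iff, ← permBar_latticeElt (.inner j h l), act_permBar_inv_crossing,
      permBar_latticeElt, map_one, crossing_latticeElt (i := .inner j h l) fun hp => hl.ne' hp.2,
      neg_smul]
    rfl
  · rintro a ha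
    obtain ⟨l, -, rfl⟩ := List.mem_map.1 ha
    exact permBar_inv_latticeElt _

theorem conj_latticeElt_last {j : Fin t} {h : Fin ((P j - 1) / 2)} {k k₀ : Fin (P j)}
    (hh : (h : ℕ) = 0) (hk : (k : ℕ) + 1 = P j) (hk₀ : (k₀ : ℕ) = 0) :
    rotElt P j * latticeElt P (.inner j h k) * (rotElt P j)⁻¹ =
      latticeElt P (.inner j h k₀) ^ order P * tailProd j h := by
  have h_pow : permBar (strands P) (latticeElt P (.inner j h k₀) ^ order P) = 1 := by
    rw [map_pow, permBar_latticeElt, one_pow]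
  have h_not_power : ¬ (LatticeIndex.inner j h k).IsPower := fun hp => by
    have := Admissible.one_lt (P := P) j
    have := hp.2
    omega
  refine eq_of_crossing_eq ?_ ?_
  · rw [permBar_conj _ (permBar_latticeElt _), map_mul, h_pow, permBar_tailProd, one_mul]
  · rw [crossing_conj _ (permBar_latticeElt _), crossing_latticeElt h_not_power, map_zsmul,
      act_rotElt_inner, finRotate_eq_of_val_add_one_eq hk hk₀, crossing_mul, h_pow, map_one,
      crossing_pow_of_permBar_eq_one (permBar_latticeElt _), crossing_latticeElt_power hh hk₀,
      crossing_tailProd, LinearEquiv.coe_one, id, Finset.smul_sum, ← Finset.sum_add_distrib,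
      Finset.sum_eq_single_of_mem k₀ (Finset.mem_univ _) fun l _ hl => ?_]
    · rw [if_neg hk₀.not_gt, add_zero, ← natCast_zsmul, smul_smul, mul_comm]
    · have hl0 : 0 < (l : ℕ) := Nat.pos_of_ne_zero fun h0 => hl (Fin.ext (h0.trans hk₀.symm))
      rw [if_pos hl0, ← natCast_zsmul, smul_smul, mul_comm, neg_smul, add_neg_cancel]

theorem conj_latticeElt_inner_of_ne {i j : Fin t} (hij : i ≠ j) (h : Fin ((P j - 1) / 2))
    (k : Fin (P j)) :
    rotElt P i * latticeElt P (.inner j h k) * (rotElt P i)⁻¹ = latticeElt P (.inner j h k) := by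
  by_cases hp : (LatticeIndex.inner j h k).IsPower
  · rw [latticeElt_power hp.1 hp.2, ((commute_rotElt i j).pow_right _).eq, mul_inv_cancel_right]
  · exact conj_latticeElt hp hp (act_rotElt_inner_of_ne hij h k)

theorem lift_genImage_eq {u v : FreeGroup (PresGen P)} (huv : PresRel P u v) :
    FreeGroup.lift (genImage P) u = FreeGroup.lift (genImage P) v := by
  cases huv <;> simp only [map_mul, map_inv, map_pow, map_list_prod, List.map_map,
    Function.comp_def, lift_genImage_symE, lift_genImage_symX]
  case lattice_comm i i' => exact commute_latticeElt i i'
  case rot_comm i j => exact commute_rotElt i j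
  case power hh hk => exact (latticeElt_power hh hk).symm
  case conj_first hh hk =>
    rw [latticeElt_power hh hk, ((Commute.refl _).pow_right _).eq, mul_inv_cancel_right]
  case conj_zero j h k hh hk hk' =>
    refine conj_latticeElt (fun hp => ?_) (fun hp => ?_) (act_rotElt_inner j h k)
    · exact (hp.2 ▸ hk).not_gt zero_lt_one
    · exact k.val.succ_ne_zero ((val_finRotate hk').symm.trans hp.2)
  case conj_last hh hk hk₀ => exact conj_latticeElt_last hh hk hk₀
  case conj_pos j h k hh =>
    have h_not_power (k) : ¬ (LatticeIndex.inner j h k).IsPower := fun hp =>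
      Nat.one_le_iff_ne_zero.1 hh hp.1
    exact conj_latticeElt (h_not_power _) (h_not_power _) (act_rotElt_inner j h k)
  case conj_cross a b hab k => exact conj_latticeElt id id (act_rotElt_mul_cross hab k)
  case conj_inner_other hij h k => exact conj_latticeElt_inner_of_ne hij h k
  case conj_cross_other hab hia hib k =>
    exact conj_latticeElt id id (act_rotElt_cross_of_ne hab hia hib k)

end Relations

/-! ### The presented group -/

section Presentation

variable {t : ℕ} {P : Fin t → ℕ}

variable (P) in
/-- The group defined by the presentation. -/
abbrev PresGroup : Type := PresentedGroup (presRelators P)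

/-- The lattice generators of the presented group. -/
def genE (i : LatticeIndex P) : PresGroup P := PresentedGroup.of (Sum.inl i)

/-- The elements `x_j` of the presented group. -/
def genX (j : Fin t) : PresGroup P := PresentedGroup.of (Sum.inr j)

variable (P) in
/-- The subgroup of the presented group that is generated by the lattice generators. -/
def latticeSubgroup : Subgroup (PresGroup P) := Subgroup.closure (Set.range genE)

theorem mk_eq_of_presRel {u v : FreeGroup (PresGen P)} (h : PresRel P u v) :
    PresentedGroup.mk (presRelators P) u = PresentedGroup.mk (presRelators P) v :=
  PresentedGroup.mk_eq_mk_of_mul_inv_mem ⟨u, v, h, rfl⟩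

theorem genE_mem (i : LatticeIndex P) : genE i ∈ latticeSubgroup P :=
  Subgroup.subset_closure ⟨i, rfl⟩

theorem commute_genE (i i' : LatticeIndex P) : Commute (genE i) (genE i') :=
  mk_eq_of_presRel (.lattice_comm i i')

theorem commute_genX (i j : Fin t) : Commute (genX (P := P) i) (genX j) :=
  mk_eq_of_presRel (.rot_comm i j)

theorem commute_of_mem_latticeSubgroup {l : PresGroup P} (hl : l ∈ latticeSubgroup P)
    (i : LatticeIndex P) : Commute l (genE i) := by
  have h_le : latticeSubgroup P ≤ Subgroup.centralizer {genE i} := by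
    rw [latticeSubgroup, Subgroup.closure_le]
    rintro _ ⟨i', rfl⟩
    exact Subgroup.mem_centralizer_singleton_iff.2 (commute_genE i' i)
  exact Subgroup.mem_centralizer_singleton_iff.1 (h_le hl)

theorem genX_conj_mem_of_presRel {j : Fin t} {i i' : LatticeIndex P}
    (h : PresRel P (symX P j * symE P i * (symX P j)⁻¹) (symE P i')) :
    genX j * genE i * (genX j)⁻¹ ∈ latticeSubgroup P := by
  have h_eq : genX j * genE i * (genX j)⁻¹ = genE i' := mk_eq_of_presRel h
  exact h_eq ▸ genE_mem i'

theorem genX_mul_genX_conj_pow_mem {a b : Fin t} (hab : a < b) (m : ℕ) (k : Fin (P a * P b)) :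
    (genX a * genX b) ^ m * genE (.cross a b hab k) * ((genX a * genX b) ^ m)⁻¹ ∈
      latticeSubgroup P := by
  induction m generalizing k with
  | zero => simpa using genE_mem _
  | succ m ih =>
    have h_shift : genX a * genX b * genE (.cross a b hab k) * (genX a * genX b)⁻¹ =
        genE (.cross a b hab (finRotate (P a * P b) k)) :=
      mk_eq_of_presRel (.conj_cross a b hab k)
    have h_next := ih (finRotate (P a * P b) k)
    rw [← h_shift] at h_next
    convert h_next using 1
    rw [pow_succ]
    group

theorem conj_cross_mem {a b : Fin t} (hab : a < b) (k : Fin (P a * P b)) {x l : PresGroup P}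
    (hl : l ∈ latticeSubgroup P) {m : ℕ} (hm : (genX a * genX b) ^ m = x * l) :
    x * genE (.cross a b hab k) * x⁻¹ ∈ latticeSubgroup P := by
  have h_mem := genX_mul_genX_conj_pow_mem hab m k
  rw [hm, mul_inv_rev, mul_assoc x l, (commute_of_mem_latticeSubgroup hl _).eq] at h_mem
  convert h_mem using 1
  group

theorem closure_genE_union_genX :
    Subgroup.closure (Set.range genE ∪ Set.range genX) = (⊤ : Subgroup (PresGroup P)) := by
  rw [← Set.Sum.elim_range, ← PresentedGroup.closure_range_of]
  exact congrArg (fun f => Subgroup.closure (Set.range f)) (Sum.elim_comp_inl_inr _)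

variable [Admissible P]

theorem genX_pow_mem (j : Fin t) : genX j ^ P j ∈ latticeSubgroup P := by
  have := Admissible.three_le (P := P) j
  have h_eq : genX j ^ P j = genE (P := P) (.inner j ⟨0, by omega⟩ ⟨0, by omega⟩) :=
    mk_eq_of_presRel (.power j _ _ rfl rfl)
  exact h_eq ▸ genE_mem _

theorem genX_zpow_mem_of_dvd {j : Fin t} {m : ℤ} (hm : (P j : ℤ) ∣ m) :
    genX j ^ m ∈ latticeSubgroup P := by
  obtain ⟨c, rfl⟩ := hm
  rw [zpow_mul, zpow_natCast]
  exact zpow_mem (genX_pow_mem j) c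

/-- By the Chinese remainder theorem some power of `x_a x_b` agrees with `x_a` up to the lattice, so
the relations for `x_a x_b` also control the conjugation by `x_a` alone. -/
theorem exists_pow_genX_mul_genX_eq {a b : Fin t} (hab : a ≠ b) :
    ∃ m : ℕ, ∃ l ∈ latticeSubgroup P, (genX a * genX b) ^ m = genX a * l := by
  obtain ⟨m, hma, hmb⟩ := Nat.chineseRemainder (Admissible.coprime (P := P) hab) 1 0
  refine ⟨m, genX a ^ (m - 1 : ℤ) * genX b ^ (m : ℤ), mul_mem (genX_zpow_mem_of_dvd ?_)
    (genX_zpow_mem_of_dvd ?_), ?_⟩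
  · exact_mod_cast Nat.modEq_iff_dvd.1 hma.symm
  · exact_mod_cast Nat.modEq_zero_iff_dvd.1 hmb
  · rw [(commute_genX a b).mul_pow, ← mul_assoc, ← zpow_one_add, add_sub_cancel, zpow_natCast,
      zpow_natCast]

theorem genX_conj_last_mem {j : Fin t} {h : Fin ((P j - 1) / 2)} {k : Fin (P j)}
    (hh : (h : ℕ) = 0) (hk : (k : ℕ) + 1 = P j) :
    genX j * genE (.inner j h k) * (genX j)⁻¹ ∈ latticeSubgroup P := by
  have h_eq := mk_eq_of_presRel (.conj_last j h k ⟨0, NeZero.pos _⟩ hh hk rfl)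
  simp only [map_mul, map_inv, map_pow, map_list_prod, List.map_map, Function.comp_def] at h_eq
  change genX j * genE (.inner j h k) * (genX j)⁻¹ = _ at h_eq
  rw [h_eq]
  refine mul_mem (pow_mem (genE_mem _) _) (Subgroup.list_prod_mem _ fun g hg => ?_)
  obtain ⟨l, -, rfl⟩ := List.mem_map.1 hg
  exact inv_mem (genE_mem _)

theorem genX_conj_inner_mem (i j : Fin t) (h : Fin ((P j - 1) / 2)) (k : Fin (P j)) :
    genX i * genE (.inner j h k) * (genX i)⁻¹ ∈ latticeSubgroup P := by
  rcases ne_or_eq i j with hij | rfl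
  · exact genX_conj_mem_of_presRel (.conj_inner_other i j hij h k)
  rcases (h : ℕ).eq_zero_or_pos with hh | hh
  · rcases (k : ℕ).eq_zero_or_pos with hk | hk
    · exact genX_conj_mem_of_presRel (.conj_first i h k hh hk)
    · rcases (Nat.succ_le_of_lt k.2).lt_or_eq with hk' | hk'
      · exact genX_conj_mem_of_presRel (.conj_zero i h k hh hk hk')
      · exact genX_conj_last_mem hh hk'
  · exact genX_conj_mem_of_presRel (.conj_pos i h k hh)

theorem genX_conj_cross_mem (i : Fin t) {a b : Fin t} (hab : a < b) (k : Fin (P a * P b)) :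
    genX i * genE (.cross a b hab k) * (genX i)⁻¹ ∈ latticeSubgroup P := by
  by_cases hia : i = a
  · subst hia
    obtain ⟨m, l, hl, hm⟩ := exists_pow_genX_mul_genX_eq (P := P) hab.ne
    exact conj_cross_mem hab k hl hm
  · by_cases hib : i = b
    · subst hib
      obtain ⟨m, l, hl, hm⟩ := exists_pow_genX_mul_genX_eq (P := P) hab.ne'
      exact conj_cross_mem hab k hl (by rw [(commute_genX a i).eq, hm])
    · exact genX_conj_mem_of_presRel (.conj_cross_other i a b hab hia hib k)

variable (P) in
theorem latticeSubgroup_normal : (latticeSubgroup P).Normal := by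
  refine normal_closure_of_conj_mem closure_genE_union_genX ?_ ?_
  · rintro _ (⟨i, rfl⟩ | ⟨i, rfl⟩) _ ⟨⟨j, h, k⟩ | ⟨a, b, hab, k⟩, rfl⟩
    · exact mul_mem (mul_mem (genE_mem _) (genE_mem _)) (inv_mem (genE_mem _))
    · exact mul_mem (mul_mem (genE_mem _) (genE_mem _)) (inv_mem (genE_mem _))
    · exact genX_conj_inner_mem i j h k
    · exact genX_conj_cross_mem i hab k
  · rintro _ (⟨i, rfl⟩ | ⟨j, rfl⟩)
    · exact ⟨0, by rw [zero_add, pow_one]; exact genE_mem i⟩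
    · exact ⟨P j - 1, by rw [Nat.sub_add_cancel (NeZero.one_le)]; exact genX_pow_mem j⟩

theorem exists_mul_powHom_eq (w : PresGroup P) :
    ∃ l ∈ latticeSubgroup P, ∃ f, l * powHom genX commute_genX f = w := by
  have := latticeSubgroup_normal P
  have h_mem : w ∈ latticeSubgroup P ⊔ (powHom (genX (P := P)) commute_genX).range := by
    rw [range_powHom, latticeSubgroup, ← Subgroup.closure_union, closure_genE_union_genX]
    exact Subgroup.mem_top w
  obtain ⟨l, hl, _, ⟨f, rfl⟩, rfl⟩ := Subgroup.mem_sup_of_normal_left.1 h_mem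
  exact ⟨l, hl, f, rfl⟩

end Presentation

section ToBraid

variable {t : ℕ} (P : Fin t → ℕ) [Admissible P]

/-- The homomorphism from the presented group to `B_n / [P_n, P_n]`. -/
def toBraid : PresGroup P →* BraidQuot (strands P) :=
  PresentedGroup.toGroup (f := genImage P) (by
    rintro _ ⟨u, v, h, rfl⟩
    rw [map_mul, map_inv, lift_genImage_eq h, mul_inv_cancel])

variable {P}

theorem toBraid_genE (i : LatticeIndex P) : toBraid P (genE i) = latticeElt P i :=
  PresentedGroup.toGroup.of _

theorem toBraid_genX (j : Fin t) : toBraid P (genX j) = rotElt P j :=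
  PresentedGroup.toGroup.of _

theorem permBar_toBraid_of_mem {l : PresGroup P} (hl : l ∈ latticeSubgroup P) :
    permBar (strands P) (toBraid P l) = 1 := by
  have h_le : latticeSubgroup P ≤ ((permBar (strands P)).comp (toBraid P)).ker := by
    rw [latticeSubgroup, Subgroup.closure_le]
    rintro _ ⟨i, rfl⟩
    rw [SetLike.mem_coe, MonoidHom.mem_ker, MonoidHom.comp_apply, toBraid_genE, permBar_latticeElt]
  exact h_le hl

theorem permBar_powHom_rotElt (f : Fin t → Multiplicative ℤ) :
    permBar (strands P) (powHom (rotElt P) commute_rotElt f) =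
      rotation P (.ofAdd fun j => ((f j).toAdd : ZMod (P j))) := by
  let unit (j : Fin t) : Multiplicative (∀ j, ZMod (P j)) := .ofAdd (Pi.single j 1)
  have h_comm (i j : Fin t) : Commute (rotation P (unit i)) (rotation P (unit j)) :=
    (Commute.all _ _).map (rotation P)
  rw [map_powHom _ h_comm permBar_rotElt, ← map_powHom (rotation P)
    (hv := fun _ _ => Commute.all _ _) h_comm (fun _ => rfl), powHom_apply]
  congr 1
  calc ∏ j, unit j ^ (f j).toAdd
      = .ofAdd (∑ j, Pi.single j ((f j).toAdd : ZMod (P j))) := by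
        simp only [unit, ← ofAdd_zsmul, ← Pi.single_smul, zsmul_one, ofAdd_sum]
    _ = _ := by rw [Finset.univ_sum_single]

theorem mem_latticeSubgroup {w : PresGroup P}
    (hw : permBar (strands P) (toBraid P w) = 1) : w ∈ latticeSubgroup P := by
  obtain ⟨l, hl, f, rfl⟩ := exists_mul_powHom_eq w
  rw [map_mul, map_mul, permBar_toBraid_of_mem hl, one_mul,
    map_powHom _ commute_rotElt toBraid_genX, permBar_powHom_rotElt] at hw
  have h_zero := rotation_injective (hw.trans (map_one _).symm)
  refine mul_mem hl (powHom_mem fun j => genX_zpow_mem_of_dvd ?_)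
  exact (ZMod.intCast_zmod_eq_zero_iff_dvd _ _).1 (congrFun h_zero j)

variable (P) in
theorem toBraid_injective : Function.Injective (toBraid P) := by
  refine (injective_iff_map_eq_one _).2 fun w hw => ?_
  have h_mem : w ∈ latticeSubgroup P := mem_latticeSubgroup (by rw [hw, map_one])
  rw [latticeSubgroup, ← range_powHom (hv := commute_genE)] at h_mem
  obtain ⟨f, rfl⟩ := h_mem
  rw [map_powHom _ commute_latticeElt toBraid_genE] at hw
  obtain rfl : f = 1 := powHom_eq_one_of_crossing_eq_zero permBar_latticeElt
    (linearIndependent_crossing_latticeElt P) (by rw [hw, crossing_one])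
  exact map_one _

end ToBraid

/-! ### The extension -/

section Extension

variable {t : ℕ} {P : Fin t → ℕ}

theorem rotElt_mem_Gamma (j : Fin t) : rotElt P j ∈ Gamma P :=
  Subgroup.subset_closure (Or.inl ⟨j, rfl⟩)

theorem pureGen_pow_order_eq {x y : Fin (strands P)} (hxy : x < y) {g : BraidQuot (strands P)}
    (hg : permBar (strands P) g = 1) (hc : crossing g = (2 * order P : ℤ) • edge s(x, y)) :
    pureGen (strands P) (x + 1) (y + 1) ^ order P = g := by
  have h_perm : permBar (strands P) (pureGen (strands P) (x + 1) (y + 1)) = 1 :=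
    permBar_pureGen (by omega) (by omega)
  refine eq_of_crossing_eq (by rw [map_pow, h_perm, one_pow, hg]) ?_
  rw [crossing_pow_of_permBar_eq_one h_perm, crossing_pureGen (by omega) (by omega) (by omega), hc,
    Nat.add_sub_cancel, Nat.add_sub_cancel, natEdge_val, ← natCast_zsmul, smul_smul, mul_comm]

variable [Admissible P]

theorem rotElt_mem_range_toBraid (j : Fin t) : rotElt P j ∈ (toBraid P).range :=
  ⟨_, toBraid_genX j⟩

theorem latticeElt_mem_range_toBraid (i : LatticeIndex P) : latticeElt P i ∈ (toBraid P).range :=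
  ⟨_, toBraid_genE i⟩

/-- For a pair that belongs to a generator `x_j ^ P_j`, conjugate the generator of the preceding
pair of its orbit by `x_j`. -/
theorem exists_mem_range_toBraid (i : LatticeIndex P) :
    ∃ g ∈ (toBraid P).range, permBar (strands P) g = 1 ∧
      crossing g = (2 * order P : ℤ) • edge (pairOf i) := by
  by_cases hi : i.IsPower
  · rcases i with ⟨j, h, k⟩ | _
    · obtain ⟨k, rfl⟩ := (finRotate (P j)).surjective k
      have h_prev : ¬ (LatticeIndex.inner j h k).IsPower := fun hk => by
        have h_val := hi.2
        rw [val_finRotate (by rw [hk.2, zero_add]; exact Admissible.one_lt j)] at h_val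
        exact Nat.succ_ne_zero _ h_val
      refine ⟨rotElt P j * latticeElt P (.inner j h k) * (rotElt P j)⁻¹,
        mul_mem (mul_mem (rotElt_mem_range_toBraid j) (latticeElt_mem_range_toBraid _))
          (inv_mem (rotElt_mem_range_toBraid j)), permBar_conj _ (permBar_latticeElt _), ?_⟩
      rw [crossing_conj _ (permBar_latticeElt _), crossing_latticeElt h_prev, map_zsmul,
        act_rotElt_inner]
    · exact hi.elim
  · exact ⟨_, latticeElt_mem_range_toBraid i, permBar_latticeElt i, crossing_latticeElt hi⟩

theorem pureGen_pow_order_mem_range_toBraid {a b : ℕ} (ha : 1 ≤ a) (hab : a < b)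
    (hb : b ≤ strands P) : pureGen (strands P) a b ^ order P ∈ (toBraid P).range := by
  obtain ⟨x, rfl⟩ := Nat.exists_eq_add_of_le' ha
  obtain ⟨y, rfl⟩ := Nat.exists_eq_add_of_le' (ha.trans hab.le)
  have hxy : (⟨x, by omega⟩ : Fin (strands P)) < ⟨y, by omega⟩ := Nat.lt_of_succ_lt_succ hab
  obtain ⟨i, hi⟩ := exists_pairOf (P := P) (mt Sym2.mk_isDiag_iff.1 hxy.ne)
  obtain ⟨g, hg, hg_perm, hg_crossing⟩ := exists_mem_range_toBraid i
  rw [hi] at hg_crossing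
  exact pureGen_pow_order_eq hxy hg_perm hg_crossing ▸ hg

theorem latticeElt_mem_Gamma (i : LatticeIndex P) : latticeElt P i ∈ Gamma P := by
  by_cases hi : i.IsPower
  · rcases i with ⟨j, h, k⟩ | _
    · exact latticeElt_power hi.1 hi.2 ▸ pow_mem (rotElt_mem_Gamma j) _
    · exact hi.elim
  · obtain ⟨x, y, hxy, h_pair⟩ : ∃ x y, x < y ∧ pairOf i = s(x, y) := by
      have h_ne := pairOf_not_isDiag i
      induction hs : pairOf i with
      | _ x y =>
        rw [hs, Sym2.mk_isDiag_iff] at h_ne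
        rcases lt_or_gt_of_ne h_ne with h | h
        · exact ⟨x, y, h, rfl⟩
        · exact ⟨y, x, h, Sym2.eq_swap⟩
    rw [← pureGen_pow_order_eq hxy (permBar_latticeElt i) (h_pair ▸ crossing_latticeElt hi)]
    exact Subgroup.subset_closure (Or.inr ⟨_, _, by omega, by omega, by omega, rfl⟩)

variable (P)

theorem range_toBraid : (toBraid P).range = Gamma P := by
  refine le_antisymm ?_ ?_
  · rw [MonoidHom.range_eq_map, ← closure_genE_union_genX, MonoidHom.map_closure,
      Subgroup.closure_le]
    rintro _ ⟨_, ⟨i, rfl⟩ | ⟨j, rfl⟩, rfl⟩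
    · exact toBraid_genE i ▸ latticeElt_mem_Gamma i
    · exact toBraid_genX (P := P) j ▸ rotElt_mem_Gamma j
  · rw [Gamma, Subgroup.closure_le]
    rintro _ (⟨j, rfl⟩ | ⟨a, b, ha, hab, hb, rfl⟩)
    · exact rotElt_mem_range_toBraid j
    · exact pureGen_pow_order_mem_range_toBraid ha hab hb

/-- The presentation of `Γ_q`. -/
noncomputable def presEquiv : PresGroup P ≃* Gamma P :=
  (MonoidHom.ofInjective (toBraid_injective P)).trans (MulEquiv.subgroupCongr (range_toBraid P))

variable {P} in
theorem coe_presEquiv_genE (i : LatticeIndex P) :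
    (presEquiv P (genE i) : BraidQuot (strands P)) = latticeElt P i :=
  toBraid_genE i

variable {P} in
theorem commute_presEquiv_genE (i i' : LatticeIndex P) :
    Commute (presEquiv P (genE i)) (presEquiv P (genE i')) :=
  (commute_genE i i').map (presEquiv P)

theorem holonomy_eq_range : holonomy P = (rotation P).range := by
  refine le_antisymm (Subgroup.zpowers_le.2 ⟨_, permBar_deltaTotal.symm⟩) ?_
  rintro _ ⟨c, rfl⟩
  have : NeZero (∏ j, P j) := NeZero.of_pos (order_pos (P := P))
  let z : ZMod (∏ j, P j) := (ZMod.prodEquivPi P Admissible.coprime).symm c.toAdd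
  have hz : c.toAdd = z.val • 1 := calc
    c.toAdd = ZMod.prodEquivPi P Admissible.coprime (z.val : ZMod (∏ j, P j)) := by
      rw [ZMod.natCast_zmod_val]
      exact (RingEquiv.apply_symm_apply _ _).symm
    _ = z.val • 1 := by rw [map_natCast, nsmul_one]
  refine Subgroup.mem_zpowers_iff.2 ⟨z.val, ?_⟩
  rw [permBar_deltaTotal, zpow_natCast, ← map_pow, ← ofAdd_nsmul, ← hz, ofAdd_toAdd]

/-- The isomorphism of the holonomy group with `ℤ/q` that the Chinese remainder theorem gives. -/
noncomputable def holonomyEquiv : holonomy P ≃* Multiplicative (ZMod (∏ j, P j)) :=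
  (MulEquiv.subgroupCongr (holonomy_eq_range P)).trans <|
    (MonoidHom.ofInjective rotation_injective).symm.trans
      (ZMod.prodEquivPi P Admissible.coprime).symm.toAddEquiv.toMultiplicative

theorem map_permBar_Gamma : (Gamma P).map (permBar (strands P)) = holonomy P := by
  refine le_antisymm ?_ ?_
  · rw [holonomy_eq_range, Gamma, MonoidHom.map_closure, Subgroup.closure_le]
    rintro _ ⟨_, ⟨j, rfl⟩ | ⟨a, b, ha, hab, hb, rfl⟩, rfl⟩
    · exact ⟨_, (permBar_rotElt j).symm⟩
    · rw [map_pow, permBar_pureGen ha (by omega), one_pow]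
      exact one_mem _
  · refine Subgroup.zpowers_le.2
      ⟨powHom (rotElt P) commute_rotElt fun _ => .ofAdd 1, powHom_mem fun j => ?_, ?_⟩
    · exact zpow_mem (rotElt_mem_Gamma j) _
    · simp only [permBar_powHom_rotElt, permBar_deltaTotal, toAdd_ofAdd, Int.cast_one]
      rfl

/-- The projection of `Γ_q` onto its holonomy group. -/
noncomputable def toHolonomy : Gamma P →* holonomy P :=
  (MulEquiv.subgroupCongr (map_permBar_Gamma P)).toMonoidHom.comp
    ((permBar (strands P)).subgroupMap (Gamma P))

theorem toHolonomy_surjective : Function.Surjective (toHolonomy P) :=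
  (MulEquiv.subgroupCongr (map_permBar_Gamma P)).surjective.comp
    ((permBar (strands P)).subgroupMap_surjective (Gamma P))

theorem ker_toHolonomy :
    (toHolonomy P).ker = (latticeSubgroup P).map (presEquiv P).toMonoidHom := by
  ext g
  obtain ⟨w, rfl⟩ := (presEquiv P).surjective g
  rw [MonoidHom.mem_ker, Subtype.ext_iff]
  refine Iff.trans ⟨mem_latticeSubgroup, permBar_toBraid_of_mem⟩ ?_
  exact (Subgroup.mem_map_equiv.trans (by rw [MulEquiv.symm_apply_apply])).symm

variable {P} {ι : Type*} [Fintype ι]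

/-- The embedding of the lattice into `Γ_q`, for an enumeration `ε` of the lattice generators. -/
noncomputable def latticeHom (ε : ι ≃ LatticeIndex P) : Multiplicative (ι → ℤ) →* Gamma P :=
  (powHom (fun i => presEquiv P (genE (ε i))) fun _ _ => commute_presEquiv_genE _ _).comp
    (MulEquiv.funMultiplicative ι ℤ).toMonoidHom

theorem latticeHom_single [DecidableEq ι] (ε : ι ≃ LatticeIndex P) (i : ι) :
    (latticeHom ε (.ofAdd (Pi.single i 1)) : BraidQuot (strands P)) = latticeElt P (ε i) := by
  calc (latticeHom ε (.ofAdd (Pi.single i 1)) : BraidQuot (strands P))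
      = powHom (fun i => presEquiv P (genE (ε i))) (fun _ _ => commute_presEquiv_genE _ _)
          (Pi.mulSingle i (.ofAdd 1)) := rfl
    _ = presEquiv P (genE (ε i)) := by rw [powHom_mulSingle, toAdd_ofAdd, zpow_one]
    _ = latticeElt P (ε i) := coe_presEquiv_genE (ε i)

theorem latticeHom_injective (ε : ι ≃ LatticeIndex P) : Function.Injective (latticeHom ε) := by
  refine Function.Injective.comp ?_ (MulEquiv.funMultiplicative ι ℤ).injective
  refine (injective_iff_map_eq_one
    (powHom _ fun _ _ => commute_presEquiv_genE _ _)).2 fun f hf => ?_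
  have h_braid : powHom (fun i => latticeElt P (ε i))
      (fun _ _ => commute_latticeElt _ _) f = 1 := by
    rw [← map_powHom (Gamma P).subtype (hv := fun _ _ => commute_presEquiv_genE _ _) _
      fun i => coe_presEquiv_genE (ε i), hf, map_one]
  exact powHom_eq_one_of_crossing_eq_zero (fun i => permBar_latticeElt (ε i))
    ((linearIndependent_crossing_latticeElt P).comp ε ε.injective) (by rw [h_braid, crossing_one])

theorem range_latticeHom (ε : ι ≃ LatticeIndex P) : (latticeHom ε).range = (toHolonomy P).ker := by
  rw [latticeHom, MonoidHom.range_comp, MonoidHom.range_eq_top.2 (MulEquiv.surjective _),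
    ← MonoidHom.range_eq_map, range_powHom, ker_toHolonomy, latticeSubgroup, MonoidHom.map_closure,
    ← Set.range_comp]
  exact congrArg Subgroup.closure (ε.surjective.range_comp fun i => presEquiv P (genE i))

end Extension

end BraidBieberbach

open BraidBieberbach in
theorem proposition4p2_general (t : ℕ) (P : Fin t → ℕ) (hodd : ∀ j, Odd (P j))
    (hone : ∀ j, 1 < P j) (hco : Pairwise fun i j => (P i).Coprime (P j)) :
    (∃ (ι : Multiplicative (Fin (latticeRank P) → ℤ) →* Gamma P) (π : Gamma P →* holonomy P)
        (ε : Fin (latticeRank P) ≃ LatticeIndex P),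
        Function.Injective ι ∧ ι.range = π.ker ∧ Function.Surjective π ∧
        (∀ g : Gamma P, (π g : Equiv.Perm (Fin (strands P))) =
          permBar (strands P) (g : BraidQuot (strands P))) ∧
        ∀ i, (ι (.ofAdd (Pi.single i 1)) : BraidQuot (strands P)) = latticeElt P (ε i)) ∧
    Nonempty (holonomy P ≃* Multiplicative (ZMod (∏ j, P j))) ∧
    ∃ φ : PresentedGroup (presRelators P) ≃* Gamma P,
      (∀ i, (φ (PresentedGroup.of (Sum.inl i)) : BraidQuot (strands P)) = latticeElt P i) ∧
      ∀ j, (φ (PresentedGroup.of (Sum.inr j)) : BraidQuot (strands P)) = rotElt P j := by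
  have : Admissible P := ⟨hodd, hone, hco⟩
  let ε := (Fintype.equivFinOfCardEq (card_latticeIndex P)).symm
  exact ⟨⟨latticeHom ε, toHolonomy P, ε, latticeHom_injective ε, range_latticeHom ε,
    toHolonomy_surjective P, fun _ => rfl, latticeHom_single ε⟩, ⟨holonomyEquiv P⟩,
    presEquiv P, toBraid_genE, toBraid_genX⟩

theorem proposition4p2 (t : ℕ) (p r P : Fin t → ℕ)
    (hp : ∀ j, (p j).Prime) (hodd : ∀ j, Odd (p j)) (hinj : Function.Injective p)
    (hr : ∀ j, 1 ≤ r j) (hP : ∀ j, P j = p j ^ r j) :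
    -- the extension, with the lattice generators as a basis of the kernel
    (∃ (ι : Multiplicative (Fin (BraidBieberbach.latticeRank P) → ℤ) →* BraidBieberbach.Gamma P)
        (π : BraidBieberbach.Gamma P →* BraidBieberbach.holonomy P)
        (ε : Fin (BraidBieberbach.latticeRank P) ≃ BraidBieberbach.LatticeIndex P),
        Function.Injective ι ∧ ι.range = π.ker ∧ Function.Surjective π ∧
        (∀ g : BraidBieberbach.Gamma P,
          (π g : Equiv.Perm (Fin (BraidBieberbach.strands P))) =
            BraidBieberbach.permBar (BraidBieberbach.strands P)
              (g : BraidBieberbach.BraidQuot (BraidBieberbach.strands P))) ∧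
        (∀ i, (ι (Multiplicative.ofAdd (Pi.single i 1)) :
            BraidBieberbach.BraidQuot (BraidBieberbach.strands P)) =
          BraidBieberbach.latticeElt P (ε i))) ∧
    -- the quotient is cyclic of order `q`
    Nonempty (BraidBieberbach.holonomy P ≃* Multiplicative (ZMod (∏ j, p j ^ r j))) ∧
    -- the presentation
    (∃ φ : PresentedGroup (BraidBieberbach.presRelators P) ≃* BraidBieberbach.Gamma P,
        (∀ i : BraidBieberbach.LatticeIndex P,
          (φ (PresentedGroup.of (Sum.inl i)) :
              BraidBieberbach.BraidQuot (BraidBieberbach.strands P)) =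
            BraidBieberbach.latticeElt P i) ∧
        (∀ j : Fin t,
          (φ (PresentedGroup.of (Sum.inr j)) :
              BraidBieberbach.BraidQuot (BraidBieberbach.strands P)) =
            BraidBieberbach.rotElt P j)) := by
  obtain rfl : P = fun j => p j ^ r j := funext hP
  exact proposition4p2_general t _ (fun j => (hodd j).pow)
    (fun j => Nat.one_lt_pow (Nat.one_le_iff_ne_zero.1 (hr j)) (hp j).one_lt)
    fun i j hij => Nat.Coprime.pow _ _ ((Nat.coprime_primes (hp i) (hp j)).2 (hinj.ne hij))
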